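/- Let $\rho$ be a density matrix of two qubits $A$ (Alice) and $B$ (Bob), let $\Gamma$ denote the partial transpose with respect to $B$, $|\psi\rangle=(|00\rangle+|11\rangle)/\sqrt2$, and let $F(\sigma)=\max\langle v|\sigma|v\rangle$, the maximum being over all maximally entangled two-qubit vectors $v$, denote the fidelity of a two-qubit state $\sigma$. Let $F^*$ be the supremum of $F(\Lambda(\rho))$ over all trace-preserving LOCC operations $\Lambda$ from two qubits to two qubits (finite-round protocols, with finite-dimensional local systems of any size in between, and limits of such operations). Then: 1. $F^*$ is attained, and it equals the maximum (which is also attained) of the semidefinite program: maximize $\frac12-\operatorname{tr}(X\rho^\Gamma)$ subject to $0\le X\le I_4$ and $-\frac{I_4}{2}\le X^\Gamma\le\frac{I_4}{2}$. 2. The program has an optimal solution of the form $X=(A\otimes I_2)|\psi\rangle\langle\psi|(A^\dagger\otimes I_2)$ with a complex $2\times2$ matrix $A$. For every $A$ for which this $X$ is optimal one has $A^\dagger A\le I_2$, and $F^*$ is attained by the following one-way LOCC protocol: Alice applies the filter $M=\sigma_yA^\dagger$, that is, $\sigma\mapsto(M\otimes I_2)\sigma(M\otimes I_2)^\dagger$;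 if the filter succeeds, Bob does nothing; if it fails, both parties prepare the pure product state $|00\rangle$. 3. If $\rho$ is entangled (not separable), then $F^*>\frac12$; every optimal $X$ of the program has rank one and is of the form in 2; and for every such $A$ the output state of the protocol in 2 has teleportation fidelity larger than $\frac23$, where the teleportation fidelity of a two-qubit state is the fidelity $\langle\varphi|T(\varphi)|\varphi\rangle$ of the output $T(\varphi)$ of the standard teleportation protocol with this state as resource, averaged uniformly over all pure one-qubit inputs $\varphi$. -/

import Mathlib

open Matrix Filter Topology
open scoped ComplexOrder Kronecker

noncomputable section

namespace TwoQubit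

/-- Operators on the Hilbert space of two qubits. The first index (Alice) and the second index
(Bob) of a pair label the computational basis vector `|a b⟩`. -/
abbrev Op : Type := Matrix (Fin 2 × Fin 2) (Fin 2 × Fin 2) ℂ

/-- Density matrices. -/
def IsState {n : Type*} [Fintype n] (ρ : Matrix n n ℂ) : Prop :=
  ρ.PosSemidef ∧ ρ.trace = 1

/-- Separable two-qubit states: finite convex combinations of product states. -/
def IsSeparable (ρ : Op) : Prop :=
  ∃ (N : ℕ) (p : Fin N → ℝ) (α β : Fin N → Matrix (Fin 2) (Fin 2) ℂ),
    (∀ i, 0 ≤ p i) ∧ ∑ i, p i = 1 ∧ (∀ i, IsState (α i)) ∧ (∀ i, IsState (β i)) ∧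
    ρ = ∑ i, (p i : ℂ) • (α i ⊗ₖ β i)

/-- Entangled means not separable. -/
def IsEntangled (ρ : Op) : Prop := ¬ IsSeparable ρ

/-- Partial transpose with respect to the second party. -/
def partialTranspose (ρ : Op) : Op :=
  Matrix.of fun x y => ρ (x.1, y.2) (y.1, x.2)

/-- The projector `|v⟩⟨v|`. -/
def proj {n : Type*} (v : n → ℂ) : Matrix n n ℂ := vecMulVec v (star v)

/-- The expectation value `⟨v|ρ|v⟩`. -/
def expect {n : Type*} [Fintype n] (ρ : Matrix n n ℂ) (v : n → ℂ) : ℝ :=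
  (star v ⬝ᵥ (ρ *ᵥ v)).re

/-- A vector of two qubits is maximally entangled if its reduced density matrix is `I / 2`. -/
def IsMaxEntangled (v : Fin 2 × Fin 2 → ℂ) : Prop :=
  (Matrix.of fun a b => v (a, b)) * (Matrix.of fun a b => v (a, b))ᴴ
    = (1 / 2 : ℂ) • (1 : Matrix (Fin 2) (Fin 2) ℂ)

/-- The fidelity (maximal singlet fraction): the maximal overlap with a maximally entangled
vector. -/
def fidelity (ρ : Op) : ℝ := sSup {f | ∃ v, IsMaxEntangled v ∧ f = expect ρ v}

/-- Finite-round LOCC protocols that start on `ℂ^d ⊗ ℂ^e` and end with two qubits, together with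
the map that they implement (all measurement outcomes are announced to the other party and
forgotten at the end). In each round one party makes a measurement on its own system, given by
finitely many Kraus operators; the dimension of its system may change, so that local ancillas can
be added and local systems discarded; the rest of the protocol may depend on the outcome. -/
inductive IsFiniteLOCC :
    (d e : ℕ) → (Matrix (Fin d × Fin e) (Fin d × Fin e) ℂ → Op) → Prop
  | done : IsFiniteLOCC 2 2 fun σ => σ
  | alice {d e K : ℕ} (d' : Fin K → ℕ) (A : ∀ k, Matrix (Fin (d' k)) (Fin d) ℂ)
      (hA : ∑ k, (A k)ᴴ * A k = 1)
      (Φ : ∀ k, Matrix (Fin (d' k) × Fin e) (Fin (d' k) × Fin e) ℂ → Op)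
      (hΦ : ∀ k, IsFiniteLOCC (d' k) e (Φ k)) :
      IsFiniteLOCC d e fun σ =>
        ∑ k, Φ k ((A k ⊗ₖ (1 : Matrix (Fin e) (Fin e) ℂ)) * σ *
          (A k ⊗ₖ (1 : Matrix (Fin e) (Fin e) ℂ))ᴴ)
  | bob {d e K : ℕ} (e' : Fin K → ℕ) (B : ∀ k, Matrix (Fin (e' k)) (Fin e) ℂ)
      (hB : ∑ k, (B k)ᴴ * B k = 1)
      (Φ : ∀ k, Matrix (Fin d × Fin (e' k)) (Fin d × Fin (e' k)) ℂ → Op)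
      (hΦ : ∀ k, IsFiniteLOCC d (e' k) (Φ k)) :
      IsFiniteLOCC d e fun σ =>
        ∑ k, Φ k (((1 : Matrix (Fin d) (Fin d) ℂ) ⊗ₖ B k) * σ *
          ((1 : Matrix (Fin d) (Fin d) ℂ) ⊗ₖ B k)ᴴ)

/-- Trace-preserving LOCC operations on two qubits: the maps implemented by finite-round
protocols, and limits of such maps, so that protocols with an unbounded number of rounds are
covered as well. -/
def IsLOCC (Λ : Op → Op) : Prop :=
  ∃ Φ : ℕ → Op → Op, (∀ j, IsFiniteLOCC 2 2 (Φ j)) ∧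
    ∀ σ, Tendsto (fun j => Φ j σ) atTop (𝓝 (Λ σ))

/-- One-way LOCC operations (from Alice to Bob): Alice makes a measurement and announces the
outcome `k`; then Bob applies a quantum channel that depends on `k`. -/
def IsOneWayLOCC (Λ : Op → Op) : Prop :=
  ∃ (K : ℕ) (A : Fin K → Matrix (Fin 2) (Fin 2) ℂ) (L : Fin K → ℕ)
    (B : ∀ k, Fin (L k) → Matrix (Fin 2) (Fin 2) ℂ),
    ∑ k, (A k)ᴴ * A k = 1 ∧ (∀ k, ∑ l, (B k l)ᴴ * B k l = 1) ∧
    ∀ σ, Λ σ = ∑ k, ∑ l, (A k ⊗ₖ B k l) * σ * (A k ⊗ₖ B k l)ᴴ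

/-- The vector `|00⟩`. -/
def ket00 : Fin 2 × Fin 2 → ℂ := Pi.single (0, 0) 1

/-- The vector `|ψ⟩ = (|00⟩ + |11⟩) / √2`. -/
def psi : Fin 2 × Fin 2 → ℂ := fun x => if x.1 = x.2 then ((1 / √2 : ℝ) : ℂ) else 0

/-- Alice applies the filter `M`. If it succeeds, the state is kept and Bob does nothing; if it
fails (with probability `tr ((I - M†M) ⊗ I) σ`), both parties prepare `|0⟩`. -/
def filterProtocol (M : Matrix (Fin 2) (Fin 2) ℂ) (σ : Op) : Op :=
  (M ⊗ₖ (1 : Matrix (Fin 2) (Fin 2) ℂ)) * σ * (M ⊗ₖ (1 : Matrix (Fin 2) (Fin 2) ℂ))ᴴ +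
    (((1 - Mᴴ * M) ⊗ₖ (1 : Matrix (Fin 2) (Fin 2) ℂ)) * σ).trace • proj ket00

/-- The constraints `0 ≤ X ≤ I` and `-I/2 ≤ X^Γ ≤ I/2`. -/
def IsFeasible (X : Op) : Prop :=
  X.PosSemidef ∧ (1 - X).PosSemidef ∧
    (partialTranspose X + (1 / 2 : ℂ) • (1 : Op)).PosSemidef ∧
    ((1 / 2 : ℂ) • (1 : Op) - partialTranspose X).PosSemidef

/-- The objective function `1/2 - tr (X ρ^Γ)`. -/
def objective (ρ X : Op) : ℝ := 1 / 2 - (X * partialTranspose ρ).trace.re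

/-- `X` is an optimal solution of the semidefinite program. -/
def IsOptimal (ρ X : Op) : Prop :=
  IsFeasible X ∧ ∀ Y, IsFeasible Y → objective ρ Y ≤ objective ρ X

/-- The operator `(A ⊗ I) |ψ⟩⟨ψ| (A† ⊗ I)`. -/
def rankOneOp (A : Matrix (Fin 2) (Fin 2) ℂ) : Op :=
  (A ⊗ₖ (1 : Matrix (Fin 2) (Fin 2) ℂ)) * proj psi * (Aᴴ ⊗ₖ (1 : Matrix (Fin 2) (Fin 2) ℂ))

/-- The Pauli matrix `σ_y`. -/
def sigmaY : Matrix (Fin 2) (Fin 2) ℂ := !![0, -Complex.I; Complex.I, 0]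

/-- The matrices `I, σ_x, σ_y, σ_z`. -/
def pauli : Fin 4 → Matrix (Fin 2) (Fin 2) ℂ :=
  ![1, !![0, 1; 1, 0], sigmaY, !![1, 0; 0, -1]]

/-- The Bell basis `(σ_k ⊗ I)|ψ⟩`. -/
def bell (k : Fin 4) : Fin 2 × Fin 2 → ℂ :=
  (pauli k ⊗ₖ (1 : Matrix (Fin 2) (Fin 2) ℂ)) *ᵥ psi

/-- The output of the standard teleportation protocol for the input vector `φ` and the shared
state `σ`: the sender measures the input (index `c`) and her half of `σ` (index `a`) in the Bell
basis; on outcome `k` the receiver applies the Pauli matrix `σ_k` to the other half of `σ`. -/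
def teleport (σ : Op) (φ : Fin 2 → ℂ) : Matrix (Fin 2) (Fin 2) ℂ :=
  ∑ k, pauli k *
    (Matrix.of fun b b' => ∑ c, ∑ a, ∑ c', ∑ a',
      star (bell k (c, a)) * (φ c * star (φ c')) * σ (a, b) (a', b') * bell k (c', a')) *
    (pauli k)ᴴ

/-- The pure qubit state with polar angles `θ`, `ω` on the Bloch sphere. -/
def blochVec (θ ω : ℝ) : Fin 2 → ℂ :=
  ![(Real.cos (θ / 2) : ℂ), Complex.exp (Complex.I * ω) * (Real.sin (θ / 2) : ℂ)]

/-- The teleportation fidelity: the average of `⟨φ|T(φ)|φ⟩` over all pure inputs `φ`, with respect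
to the uniform distribution on the Bloch sphere. -/
def teleportationFidelity (σ : Op) : ℝ :=
  (1 / (4 * Real.pi)) * ∫ ω in (0 : ℝ)..(2 * Real.pi), ∫ θ in (0 : ℝ)..Real.pi,
    expect (teleport σ (blochVec θ ω)) (blochVec θ ω) * Real.sin θ

end TwoQubit

end

open TwoQubit

/-! Upper bound. In the Heisenberg picture each LOCC round pulls an operator back through product
Kraus operators, which resolve the identity both before and after the partial transpose. The
constraints of the program therefore survive the whole protocol (`exists_isGenFeasible_adjoint`). A
maximally entangled projector satisfies them, so every fidelity reachable in finitely many rounds is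
tr(Yρ) for a feasible Y. The involution Y ↦ 1/2 - Y^Γ preserves feasibility and turns tr(Yρ) into
the objective; limits follow by continuity.

Attainment. An optimizer exists by compactness. A positive X that is not a multiple of a rank-one
projector has a plane in its range, and every plane of two-qubit vectors contains a product vector.
Subtracting a multiple of a product projector keeps X feasible and does not lower the objective, so
induction on the rank reaches `rankOneOp A` (`exists_optimal_rankOneOp`). Feasibility of this
operator means that A is a contraction. As |ψ⟩⟨ψ|^Γ is half the swap, i.e. 1/2 minus the singlet
projector, the filter σ_y A† yields overlap with ψ equal to the objective (`expect_filterProtocol`).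

Entangled states. By Peres–Horodecki, proved here by subtracting product vectors common to the
ranges of ρ and ρ^Γ, some direction makes ρ^Γ negative, whence F > 1/2. If an optimizer had higher
rank, removing product vectors would lead to an optimal `rankOneOp A` to which a product projector
can still be added. Perturbing A along that product vector then contradicts optimality or makes ρ
separable (`false_of_optimal_add_proj`). Finally, teleportation through a state with overlap f with
ψ has fidelity (2f + 1)/3, and f > 1/2. -/

noncomputable section

namespace TwoQubit

/-! ### Sesquilinear forms, and rank reduction of positive matrices. -/

section Forms
variable {n : Type*}

lemma proj_apply (v : n → ℂ) (i j : n) : proj v i j = v i * star (v j) := rfl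

lemma isHermitian_real_smul {M : Matrix n n ℂ} (hM : M.IsHermitian) (t : ℝ) :
    ((t : ℂ) • M).IsHermitian := by
  rw [IsHermitian, conjTranspose_smul, hM.eq, Complex.star_def, Complex.conj_ofReal]

lemma posSemidef_real_smul {M : Matrix n n ℂ} (hM : M.PosSemidef) {t : ℝ} (ht : 0 ≤ t) :
    ((t : ℂ) • M).PosSemidef :=
  hM.smul (by exact_mod_cast ht)

lemma proj_smul (c : ℂ) (v : n → ℂ) : proj (c • v) = ((Complex.normSq c : ℝ) : ℂ) • proj v := by
  ext i j
  simp only [proj, vecMulVec_apply, Pi.smul_apply, Pi.star_apply, smul_eq_mul, star_mul',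
    Matrix.smul_apply, Complex.star_def, ← Complex.mul_conj c]
  ring

variable [Fintype n]

/-- The sesquilinear form `⟨x|M|y⟩`. -/
def sesq (M : Matrix n n ℂ) (x y : n → ℂ) : ℂ := star x ⬝ᵥ (M *ᵥ y)

lemma sesq_add_left (M : Matrix n n ℂ) (x y z : n → ℂ) :
    sesq M (x + y) z = sesq M x z + sesq M y z := by
  simp [sesq, add_dotProduct]

lemma sesq_add_right (M : Matrix n n ℂ) (x y z : n → ℂ) :
    sesq M x (y + z) = sesq M x y + sesq M x z := by
  simp [sesq, mulVec_add, dotProduct_add]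

lemma sesq_smul_left (M : Matrix n n ℂ) (c : ℂ) (x y : n → ℂ) :
    sesq M (c • x) y = star c * sesq M x y := by
  simp [sesq, smul_dotProduct]

lemma sesq_smul_right (M : Matrix n n ℂ) (c : ℂ) (x y : n → ℂ) :
    sesq M x (c • y) = c * sesq M x y := by
  simp [sesq, mulVec_smul, dotProduct_smul]

lemma sesq_add_mat (M N : Matrix n n ℂ) (x y : n → ℂ) :
    sesq (M + N) x y = sesq M x y + sesq N x y := by
  simp [sesq, add_mulVec, dotProduct_add]

lemma sesq_sub_mat (M N : Matrix n n ℂ) (x y : n → ℂ) :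
    sesq (M - N) x y = sesq M x y - sesq N x y := by
  simp [sesq, sub_mulVec, dotProduct_sub]

lemma sesq_smul_mat (c : ℂ) (M : Matrix n n ℂ) (x y : n → ℂ) :
    sesq (c • M) x y = c * sesq M x y := by
  simp [sesq, smul_mulVec, dotProduct_smul]

lemma sesq_one [DecidableEq n] (x y : n → ℂ) : sesq 1 x y = star x ⬝ᵥ y := by
  simp [sesq]

lemma star_sesq {M : Matrix n n ℂ} (hM : M.IsHermitian) (x y : n → ℂ) :
    star (sesq M x y) = sesq M y x := by
  rw [sesq, sesq, star_dotProduct, star_star, star_mulVec, hM.eq, dotProduct_mulVec]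

lemma sesq_proj (v x y : n → ℂ) : sesq (proj v) x y = (star x ⬝ᵥ v) * (star v ⬝ᵥ y) := by
  simp [sesq, proj, vecMulVec_mulVec, mul_comm]

lemma sesq_proj_self_re (v x : n → ℂ) : (sesq (proj v) x x).re = Complex.normSq (star x ⬝ᵥ v) := by
  rw [sesq_proj, star_dotProduct v x, Complex.star_def, Complex.mul_conj, Complex.ofReal_re]

lemma trace_mul_proj (M : Matrix n n ℂ) (v : n → ℂ) : (M * proj v).trace = sesq M v v := by
  rw [proj, mul_vecMulVec, trace_vecMulVec, sesq, dotProduct_comm]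

lemma sesq_self_re_nonneg {M : Matrix n n ℂ} (hM : M.PosSemidef) (x : n → ℂ) :
    0 ≤ (sesq M x x).re := hM.re_dotProduct_nonneg x

lemma sesq_self_eq_re {M : Matrix n n ℂ} (hM : M.IsHermitian) (x : n → ℂ) :
    sesq M x x = ((sesq M x x).re : ℂ) := by
  have h := star_sesq hM x x
  exact (Complex.conj_eq_iff_real.mp h).elim fun r hr => by rw [hr, Complex.ofReal_re]

lemma posSemidef_of_sesq {M : Matrix n n ℂ} (hM : M.IsHermitian)
    (h : ∀ x, 0 ≤ (sesq M x x).re) : M.PosSemidef := by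
  refine PosSemidef.of_dotProduct_mulVec_nonneg hM fun x => ?_
  change 0 ≤ sesq M x x
  rw [sesq_self_eq_re hM]
  exact_mod_cast h x

lemma mulVec_eq_zero_of_sesq {M : Matrix n n ℂ} (hM : M.PosSemidef) {x : n → ℂ}
    (h : (sesq M x x).re = 0) : M *ᵥ x = 0 := by
  rw [← hM.dotProduct_mulVec_zero_iff]
  change sesq M x x = 0
  rw [sesq_self_eq_re hM.1, h, Complex.ofReal_zero]

lemma posSemidef_proj (v : n → ℂ) : (proj v).PosSemidef := posSemidef_vecMulVec_self_star v

lemma isHermitian_proj (v : n → ℂ) : (proj v).IsHermitian := (posSemidef_proj v).1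

/-- Subtracting a small multiple of the projector on a vector in the range of a positive
semidefinite matrix preserves positivity. -/
lemma posSemidef_sub_proj {P : Matrix n n ℂ} (hP : P.PosSemidef) (u : n → ℂ) {t : ℝ}
    (ht : 0 ≤ t) (hts : t * (sesq P u u).re ≤ 1) :
    (P - (t : ℂ) • proj (P *ᵥ u)).PosSemidef := by
  refine posSemidef_of_sesq (hP.1.sub (isHermitian_real_smul (isHermitian_proj _) t)) fun x => ?_
  set z : ℂ := sesq P x u with hz
  have hz' : sesq P u x = star z := (star_sesq hP.1 x u).symm
  -- Positivity at x - t z̄ u gives ⟨x|P|x⟩ ≥ (2t - t²⟨u|P|u⟩)|z|², and t⟨u|P|u⟩ ≤ 1 makes the right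
  -- side at least t|z|².
  have h1 := sesq_self_re_nonneg hP (x + (-((t : ℂ) * star z)) • u)
  have h2 : (sesq (P - (t : ℂ) • proj (P *ᵥ u)) x x).re
      = (sesq P x x).re - t * Complex.normSq z := by
    rw [sesq_sub_mat, sesq_smul_mat, Complex.sub_re, Complex.re_ofReal_mul, sesq_proj_self_re]
    rfl
  have h3 : (sesq P (x + (-((t : ℂ) * star z)) • u) (x + (-((t : ℂ) * star z)) • u)).re
      = (sesq P x x).re - 2 * t * Complex.normSq z
        + t ^ 2 * Complex.normSq z * (sesq P u u).re := by
    simp only [sesq_add_left, sesq_add_right, sesq_smul_left, sesq_smul_right, hz', ← hz]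
    rw [sesq_self_eq_re hP.1 u]
    simp [Complex.normSq_apply]
    ring
  rw [h2]
  have h4 : t ^ 2 * Complex.normSq z * (sesq P u u).re ≤ t * Complex.normSq z := by
    have := mul_le_mul_of_nonneg_left hts (mul_nonneg ht (Complex.normSq_nonneg z))
    nlinarith
  rw [h3] at h1
  linarith

/-- A nonzero vector in the range of a positive semidefinite matrix has positive expectation. -/
lemma sesq_pos_of_mulVec_ne_zero {P : Matrix n n ℂ} (hP : P.PosSemidef) {u : n → ℂ}
    (hu : P *ᵥ u ≠ 0) : 0 < (sesq P u u).re :=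
  lt_of_le_of_ne (sesq_self_re_nonneg hP u) fun h => hu (mulVec_eq_zero_of_sesq hP h.symm)

lemma sub_proj_mulVec {P : Matrix n n ℂ} (hP : P.IsHermitian) (u x : n → ℂ) (t : ℝ) :
    (P - (t : ℂ) • proj (P *ᵥ u)) *ᵥ x = P *ᵥ x - ((t : ℂ) * sesq P u x) • (P *ᵥ u) := by
  rw [sub_mulVec, smul_mulVec, proj, vecMulVec_mulVec]
  rw [star_mulVec, hP.eq, ← dotProduct_mulVec]
  ext i
  simp [sesq]
  ring

lemma rank_add_finrank_ker (M : Matrix n n ℂ) :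
    M.rank + Module.finrank ℂ (LinearMap.ker M.mulVecLin) = Fintype.card n := by
  rw [Matrix.rank, LinearMap.finrank_range_add_finrank_ker, Module.finrank_fintype_fun_eq_card]

lemma rank_le_of_ker {M N : Matrix n n ℂ} (h : ∀ x, M *ᵥ x = 0 → N *ᵥ x = 0) :
    N.rank ≤ M.rank := by
  have h1 := rank_add_finrank_ker M
  have h2 := rank_add_finrank_ker N
  have h3 : LinearMap.ker M.mulVecLin ≤ LinearMap.ker N.mulVecLin := fun x hx => by
    simpa using h x (by simpa using hx)
  have := Submodule.finrank_mono h3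
  omega

lemma rank_lt_of_ker {M N : Matrix n n ℂ} (h : ∀ x, M *ᵥ x = 0 → N *ᵥ x = 0) {u : n → ℂ}
    (hM : M *ᵥ u ≠ 0) (hN : N *ᵥ u = 0) : N.rank < M.rank := by
  have h1 := rank_add_finrank_ker M
  have h2 := rank_add_finrank_ker N
  have h3 : LinearMap.ker M.mulVecLin < LinearMap.ker N.mulVecLin := by
    refine lt_of_le_of_ne (fun x hx => by simpa using h x (by simpa using hx)) fun he => hM ?_
    have : u ∈ LinearMap.ker N.mulVecLin := by simpa using hN
    rw [← he] at this
    simpa using this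
  have := Submodule.finrank_lt_finrank_of_lt h3
  omega

lemma rank_sub_proj_le {P : Matrix n n ℂ} (hP : P.IsHermitian) (u : n → ℂ) (t : ℝ) :
    (P - (t : ℂ) • proj (P *ᵥ u)).rank ≤ P.rank := by
  refine rank_le_of_ker fun x hx => ?_
  rw [sub_proj_mulVec hP, hx, sesq, hx]
  simp

lemma rank_sub_proj_lt {P : Matrix n n ℂ} (hP : P.PosSemidef) {u : n → ℂ} (hu : P *ᵥ u ≠ 0)
    {t : ℝ} (ht : t * (sesq P u u).re = 1) :
    (P - (t : ℂ) • proj (P *ᵥ u)).rank < P.rank := by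
  refine rank_lt_of_ker (fun x hx => ?_) hu ?_
  · rw [sub_proj_mulVec hP.1, hx, sesq, hx]
    simp
  · rw [sub_proj_mulVec hP.1, sesq_self_eq_re hP.1, ← Complex.ofReal_mul, ht]
    simp

/-- The range of a Hermitian matrix is the orthogonal complement of its kernel. -/
lemma exists_mulVec_eq {P : Matrix n n ℂ} (hP : P.IsHermitian) {v : n → ℂ}
    (h : ∀ x, P *ᵥ x = 0 → star x ⬝ᵥ v = 0) : ∃ u, P *ᵥ u = v := by
  classical
  have hs : (toEuclideanLin P).IsSymmetric := isSymmetric_toEuclideanLin_iff.mpr hP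
  have hr : LinearMap.range (toEuclideanLin P) = (LinearMap.ker (toEuclideanLin P))ᗮ := by
    rw [← hs.orthogonal_range, Submodule.orthogonal_orthogonal]
  have hv : WithLp.toLp 2 v ∈ LinearMap.range (toEuclideanLin P) := by
    rw [hr, Submodule.mem_orthogonal]
    intro x hx
    have hx' : P *ᵥ x.ofLp = 0 := by
      have := LinearMap.mem_ker.mp hx
      rw [toLpLin_apply] at this
      simpa using this
    have := h _ hx'
    rw [EuclideanSpace.inner_eq_star_dotProduct, dotProduct_comm]
    exact this
  obtain ⟨u, hu⟩ := hv
  refine ⟨u.ofLp, ?_⟩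
  rw [toLpLin_apply] at hu
  simpa using hu

lemma exists_mulVec_ne_zero {M : Matrix n n ℂ} (h : M ≠ 0) : ∃ u, M *ᵥ u ≠ 0 := by
  classical
  by_contra! hc
  exact h (Matrix.ext_of_mulVec_single fun i => by rw [hc, zero_mulVec])

/-- A positive semidefinite matrix is a projector up to scaling, or its range contains two
independent vectors. -/
lemma eq_proj_or_exists_range {X : Matrix n n ℂ} (hX : X.PosSemidef) :
    (∃ a, X = proj a) ∨ ∃ u v : n → ℂ, ∀ α β : ℂ, α • (X *ᵥ u) + β • (X *ᵥ v) = 0 →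
      α = 0 ∧ β = 0 := by
  by_cases h0 : X = 0
  · exact Or.inl ⟨0, by simp [h0, proj]⟩
  obtain ⟨u, hu⟩ := exists_mulVec_ne_zero h0
  have hs := sesq_pos_of_mulVec_ne_zero hX hu
  set s := (sesq X u u).re
  by_cases h1 : X - ((s⁻¹ : ℝ) : ℂ) • proj (X *ᵥ u) = 0
  · left
    refine ⟨((√(s⁻¹) : ℝ) : ℂ) • (X *ᵥ u), ?_⟩
    rw [proj_smul, Complex.normSq_ofReal, Real.mul_self_sqrt (inv_nonneg.mpr hs.le)]
    exact sub_eq_zero.mp h1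
  · right
    obtain ⟨w, hw⟩ := exists_mulVec_ne_zero h1
    rw [sub_proj_mulVec hX.1] at hw
    refine ⟨u, w, fun α β h => ?_⟩
    have hβ : β = 0 := by
      by_contra hβ
      apply hw
      have h2 : X *ᵥ w = (-(α / β)) • (X *ᵥ u) := by
        have : β • (X *ᵥ w) = (-α) • (X *ᵥ u) := by
          rw [neg_smul]; exact eq_neg_of_add_eq_zero_right h
        calc X *ᵥ w = β⁻¹ • (β • (X *ᵥ w)) := by rw [smul_smul, inv_mul_cancel₀ hβ, one_smul]
          _ = _ := by rw [this, smul_smul]; congr 1; ring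
      have h3 : sesq X u w = (-(α / β)) * (s : ℂ) := by
        rw [sesq, h2, dotProduct_smul, smul_eq_mul]
        congr 1
        exact sesq_self_eq_re hX.1 u
      rw [h3, h2, ← sub_smul]
      have : (-(α / β)) - ((s⁻¹ : ℝ) : ℂ) * (-(α / β) * (s : ℂ)) = 0 := by
        have : (s : ℂ) ≠ 0 := by exact_mod_cast hs.ne'
        push_cast
        field_simp
        ring
      rw [this, zero_smul]
    subst hβ
    simp only [zero_smul, add_zero, smul_eq_zero, hu, or_false] at h
    exact ⟨h, rfl⟩

open scoped MatrixOrder in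
lemma exists_eq_mul_conjTranspose [DecidableEq n] {P : Matrix n n ℂ} (hP : P.PosSemidef) :
    ∃ B : Matrix n n ℂ, P = B * Bᴴ :=
  CStarAlgebra.nonneg_iff_eq_mul_star_self.mp hP.nonneg

end Forms

/-! ### Partial transpose on systems of any size. -/

section PartialTranspose
variable {m n m' n' : Type*}

/-- The partial transpose with respect to the second factor, for systems of any size. -/
def pt (M : Matrix (m × n) (m × n) ℂ) : Matrix (m × n) (m × n) ℂ :=
  Matrix.of fun x y => M (x.1, y.2) (y.1, x.2)

lemma pt_apply (M : Matrix (m × n) (m × n) ℂ) (x y : m × n) :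
    pt M x y = M (x.1, y.2) (y.1, x.2) := rfl

@[simp] lemma pt_pt (M : Matrix (m × n) (m × n) ℂ) : pt (pt M) = M := rfl

@[simp] lemma pt_zero : pt (0 : Matrix (m × n) (m × n) ℂ) = 0 := rfl

lemma pt_sub (M N : Matrix (m × n) (m × n) ℂ) : pt (M - N) = pt M - pt N := rfl

lemma pt_smul (c : ℂ) (M : Matrix (m × n) (m × n) ℂ) : pt (c • M) = c • pt M := rfl

lemma pt_sum {ι : Type*} (s : Finset ι) (M : ι → Matrix (m × n) (m × n) ℂ) :
    pt (∑ i ∈ s, M i) = ∑ i ∈ s, pt (M i) := by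
  ext x y
  simp [pt_apply, Matrix.sum_apply]

@[simp] lemma pt_one [DecidableEq m] [DecidableEq n] :
    pt (1 : Matrix (m × n) (m × n) ℂ) = 1 := by
  ext ⟨a, b⟩ ⟨c, d⟩
  simp only [pt_apply, Matrix.one_apply, Prod.mk.injEq]
  congr 1
  simp [eq_comm]

lemma pt_kronecker (α : Matrix m m ℂ) (β : Matrix n n ℂ) : pt (α ⊗ₖ β) = α ⊗ₖ βᵀ := rfl

lemma pt_isHermitian {M : Matrix (m × n) (m × n) ℂ} (hM : M.IsHermitian) : (pt M).IsHermitian := by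
  ext x y
  exact congrFun (congrFun hM (x.1, y.2)) (y.1, x.2)

variable [Fintype m] [Fintype n]

lemma trace_pt (M : Matrix (m × n) (m × n) ℂ) : (pt M).trace = M.trace := rfl

/-- The transpose exchanges Bob's row and column indices; inside sums this is a relabelling of the
outer and the inner variable. -/
lemma sum_swap_outer_inner {ι κ : Type*} [Fintype ι] [Fintype κ] (f : ι → κ → ι → ℂ) :
    ∑ b, ∑ c, ∑ d, f b c d = ∑ b, ∑ c, ∑ d, f d c b := by
  rw [Finset.sum_comm]
  conv_rhs => rw [Finset.sum_comm]
  exact Finset.sum_congr rfl fun c _ => Finset.sum_comm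

lemma trace_pt_mul (M N : Matrix (m × n) (m × n) ℂ) : (pt M * N).trace = (M * pt N).trace := by
  simp only [Matrix.trace, Matrix.diag, Matrix.mul_apply, pt_apply, Fintype.sum_prod_type]
  exact Finset.sum_congr rfl fun a _ =>
    sum_swap_outer_inner fun b c d => M (a, d) (c, b) * N (c, d) (a, b)

/-- Bob's operator is replaced by its entrywise conjugate, so a local operation remains one after
the transpose. This carries the bounds on X^Γ through LOCC. -/
lemma pt_conj (A : Matrix m' m ℂ) (B : Matrix n' n ℂ) (M : Matrix (m × n) (m × n) ℂ) :
    pt ((A ⊗ₖ B) * M * (A ⊗ₖ B)ᴴ) = (A ⊗ₖ B.map star) * pt M * (A ⊗ₖ B.map star)ᴴ := by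
  ext ⟨a, b⟩ ⟨c, d⟩
  simp only [pt_apply, Matrix.mul_apply, kronecker_apply, Fintype.sum_prod_type,
    conjTranspose_apply, Matrix.map_apply, star_mul', star_star, Finset.sum_mul]
  refine Finset.sum_congr rfl fun c' _ => ?_
  rw [sum_swap_outer_inner]
  refine Finset.sum_congr rfl fun _ _ => Finset.sum_congr rfl fun _ _ =>
    Finset.sum_congr rfl fun _ _ => by ring

end PartialTranspose

/-! ### Product vectors of two qubits. -/

section ProductVectors

/-- The product vector `e ⊗ f`. -/
def prodVec (e f : Fin 2 → ℂ) : Fin 2 × Fin 2 → ℂ := fun x => e x.1 * f x.2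

lemma prodVec_ne_zero {e f : Fin 2 → ℂ} (he : e ≠ 0) (hf : f ≠ 0) : prodVec e f ≠ 0 := by
  obtain ⟨i, hi⟩ := Function.ne_iff.mp he
  obtain ⟨j, hj⟩ := Function.ne_iff.mp hf
  exact Function.ne_iff.mpr ⟨(i, j), mul_ne_zero hi hj⟩

lemma left_ne_zero_of_prodVec {e f : Fin 2 → ℂ} (h : prodVec e f ≠ 0) : e ≠ 0 := by
  rintro rfl
  exact h (by ext; simp [prodVec])

lemma right_ne_zero_of_prodVec {e f : Fin 2 → ℂ} (h : prodVec e f ≠ 0) : f ≠ 0 := by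
  rintro rfl
  exact h (by ext; simp [prodVec])

lemma kronecker_mulVec_prodVec (S T : Matrix (Fin 2) (Fin 2) ℂ) (e f : Fin 2 → ℂ) :
    (S ⊗ₖ T) *ᵥ prodVec e f = prodVec (S *ᵥ e) (T *ᵥ f) := by
  ext ⟨a, b⟩
  simp [prodVec, mulVec, dotProduct, Fintype.sum_prod_type]
  ring

lemma proj_prodVec (e f : Fin 2 → ℂ) : proj (prodVec e f) = proj e ⊗ₖ proj f := by
  ext ⟨a, b⟩ ⟨c, d⟩
  simp [prodVec, proj, vecMulVec_apply]
  ring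

/-- Between product vectors the transpose only exchanges and conjugates Bob's factors. This is the
bridge between positivity of M and of its partial transpose. -/
lemma sesq_pt_prodVec (M : Op) (e f g h : Fin 2 → ℂ) :
    sesq (pt M) (prodVec e f) (prodVec g h) =
      sesq M (prodVec e (star h)) (prodVec g (star f)) := by
  simp [sesq, prodVec, pt_apply, mulVec, dotProduct, Fintype.sum_prod_type]
  ring

lemma exists_ne_zero_annihilator (a b : ℂ) : ∃ f : Fin 2 → ℂ, f ≠ 0 ∧ a * f 0 + b * f 1 = 0 := by
  by_cases h : a = 0 ∧ b = 0
  · exact ⟨![1, 0], by simp, by simp [h.1]⟩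
  · refine ⟨![b, -a], fun h' => h ?_, by simp; ring⟩
    have h0 := congrFun h' 0
    have h1 := congrFun h' 1
    simp at h0 h1
    exact ⟨h1, h0⟩

/-- Read as a 2×2 matrix, v has zero determinant and hence rank at most one. -/
lemma exists_eq_prodVec {v : Fin 2 × Fin 2 → ℂ} (h : v (0, 0) * v (1, 1) = v (0, 1) * v (1, 0)) :
    ∃ e f, v = prodVec e f := by
  by_cases h0 : v (0, 0) = 0
  · by_cases h1 : v (0, 1) = 0
    · refine ⟨![0, 1], ![v (1, 0), v (1, 1)], ?_⟩
      ext ⟨a, b⟩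
      fin_cases a <;> fin_cases b <;> simp [prodVec, h0, h1]
    · refine ⟨![1, v (1, 1) / v (0, 1)], ![v (0, 0), v (0, 1)], ?_⟩
      have h2 : v (1, 0) = 0 := by
        rw [h0, zero_mul] at h
        exact (mul_eq_zero.mp h.symm).resolve_left h1
      ext ⟨a, b⟩
      fin_cases a <;> fin_cases b <;> simp [prodVec, h0, h1, h2]
  · refine ⟨![1, v (1, 0) / v (0, 0)], ![v (0, 0), v (0, 1)], ?_⟩
    ext ⟨a, b⟩
    fin_cases a <;> fin_cases b <;> simp [prodVec, h0]
    field_simp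
    rw [mul_comm, h, mul_comm]

lemma exists_quadratic_root {a : ℂ} (ha : a ≠ 0) (b c : ℂ) : ∃ x : ℂ, a * (x * x) + b * x + c = 0 := by
  obtain ⟨s, hs⟩ := IsAlgClosed.exists_pow_nat_eq (discrim a b c) (n := 2) (by norm_num)
  exact exists_quadratic_eq_zero ha ⟨s, by rw [← hs, sq]⟩

/-- Every plane in the space of two qubits contains a product vector. -/
lemma exists_prodVec_span (u v : Fin 2 × Fin 2 → ℂ) :
    ∃ α β : ℂ, (α ≠ 0 ∨ β ≠ 0) ∧ ∃ e f, α • u + β • v = prodVec e f := by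
  by_cases hu : u (0, 0) * u (1, 1) = u (0, 1) * u (1, 0)
  · exact ⟨1, 0, Or.inl one_ne_zero, by simpa using exists_eq_prodVec hu⟩
  -- The determinant of x u + v is quadratic in x, with leading coefficient det u ≠ 0.
  · obtain ⟨x, hx⟩ := exists_quadratic_root (sub_ne_zero.mpr hu)
      (u (0, 0) * v (1, 1) + v (0, 0) * u (1, 1) - u (0, 1) * v (1, 0) - v (0, 1) * u (1, 0))
      (v (0, 0) * v (1, 1) - v (0, 1) * v (1, 0))
    refine ⟨x, 1, Or.inr one_ne_zero, exists_eq_prodVec ?_⟩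
    simp only [Pi.add_apply, Pi.smul_apply, smul_eq_mul]
    linear_combination hx

/-- A kernel without product vectors is at most one-dimensional. -/
lemma exists_ker_le_span {M : Op}
    (h : ∀ e f, e ≠ 0 → f ≠ 0 → M *ᵥ prodVec e f ≠ 0) :
    ∃ k, M *ᵥ k = 0 ∧ ∀ x, M *ᵥ x = 0 → ∃ c : ℂ, x = c • k := by
  by_cases h0 : ∀ x, M *ᵥ x = 0 → x = 0
  · exact ⟨0, by simp, fun x hx => ⟨0, by simp [h0 x hx]⟩⟩
  push Not at h0
  obtain ⟨k, hk, hk0⟩ := h0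
  refine ⟨k, hk, fun x hx => ?_⟩
  obtain ⟨α, β, hαβ, e, f, hef⟩ := exists_prodVec_span k x
  have hz : α • k + β • x = 0 := by
    by_contra hne
    rw [hef] at hne
    refine h e f (left_ne_zero_of_prodVec hne) (right_ne_zero_of_prodVec hne) ?_
    rw [← hef, mulVec_add, mulVec_smul, mulVec_smul, hk, hx]
    simp
  have hβ : β ≠ 0 := by
    rintro rfl
    simp [hk0] at hz
    simp [hz] at hαβ
  refine ⟨-(α / β), ?_⟩
  have : β • x = (-α) • k := by rw [neg_smul]; exact eq_neg_of_add_eq_zero_right hz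
  calc x = β⁻¹ • (β • x) := by rw [smul_smul, inv_mul_cancel₀ hβ, one_smul]
    _ = _ := by rw [this, smul_smul]; congr 1; ring

end ProductVectors

/-! ### Separable cone and the Peres–Horodecki theorem. -/

section PeresHorodecki

/-- The cone generated by the products of positive semidefinite matrices. -/
def sepCone : AddSubmonoid Op :=
  AddSubmonoid.closure {X | ∃ α β : Matrix (Fin 2) (Fin 2) ℂ,
    α.PosSemidef ∧ β.PosSemidef ∧ X = α ⊗ₖ β}

lemma kronecker_mem_sepCone {α β : Matrix (Fin 2) (Fin 2) ℂ} (hα : α.PosSemidef)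
    (hβ : β.PosSemidef) : α ⊗ₖ β ∈ sepCone :=
  AddSubmonoid.subset_closure ⟨α, β, hα, hβ, rfl⟩

lemma smul_proj_mem_sepCone (e f : Fin 2 → ℂ) {t : ℝ} (ht : 0 ≤ t) :
    (t : ℂ) • proj (prodVec e f) ∈ sepCone := by
  rw [proj_prodVec, ← smul_kronecker]
  exact kronecker_mem_sepCone (posSemidef_real_smul (posSemidef_proj e) ht) (posSemidef_proj f)

lemma conj_mem_sepCone (S T : Matrix (Fin 2) (Fin 2) ℂ) {ρ : Op} (h : ρ ∈ sepCone) :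
    (S ⊗ₖ T) * ρ * (S ⊗ₖ T)ᴴ ∈ sepCone := by
  induction h using AddSubmonoid.closure_induction with
  | mem x hx =>
    obtain ⟨α, β, hα, hβ, rfl⟩ := hx
    rw [conjTranspose_kronecker, ← mul_kronecker_mul, ← mul_kronecker_mul]
    exact kronecker_mem_sepCone (hα.mul_mul_conjTranspose_same S) (hβ.mul_mul_conjTranspose_same T)
  | zero => simp
  | add x y _ _ hx hy => rw [mul_add, add_mul]; exact add_mem hx hy

lemma pt_mem_sepCone {ρ : Op} (h : ρ ∈ sepCone) : pt ρ ∈ sepCone := by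
  induction h using AddSubmonoid.closure_induction with
  | mem x hx =>
    obtain ⟨α, β, hα, hβ, rfl⟩ := hx
    exact kronecker_mem_sepCone hα hβ.transpose
  | zero => simp
  | add x y _ _ hx hy => exact add_mem hx hy

lemma exists_normalization {α : Matrix (Fin 2) (Fin 2) ℂ} (hα : α.PosSemidef) :
    ∃ (p : ℝ) (σ : Matrix (Fin 2) (Fin 2) ℂ), 0 ≤ p ∧ IsState σ ∧ α = (p : ℂ) • σ := by
  obtain ⟨r, hr0, hr⟩ : ∃ r : ℝ, 0 ≤ r ∧ (r : ℂ) = α.trace := by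
    have h := hα.trace_nonneg
    rw [Complex.nonneg_iff] at h
    exact ⟨α.trace.re, h.1, Complex.ext (by simp) (by simp [← h.2])⟩
  by_cases h0 : r = 0
  · refine ⟨0, proj ![1, 0], le_rfl, ⟨posSemidef_proj _, ?_⟩, ?_⟩
    · simp [Matrix.trace, proj_apply, Fin.sum_univ_two]
    · rw [h0, Complex.ofReal_zero, eq_comm, hα.trace_eq_zero_iff] at hr
      simp [hr]
  · have h0' : (r : ℂ) ≠ 0 := by exact_mod_cast h0
    refine ⟨r, ((r⁻¹ : ℝ) : ℂ) • α, hr0,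
      ⟨posSemidef_real_smul hα (inv_nonneg.mpr hr0), ?_⟩, ?_⟩
    · rw [trace_smul, ← hr, smul_eq_mul, Complex.ofReal_inv, inv_mul_cancel₀ h0']
    · rw [smul_smul, Complex.ofReal_inv, mul_inv_cancel₀ h0', one_smul]

lemma isSeparable_of_mem_sepCone {ρ : Op} (h : ρ ∈ sepCone) (htr : ρ.trace = 1) :
    IsSeparable ρ := by
  have key : ∃ (N : ℕ) (p : Fin N → ℝ) (α β : Fin N → Matrix (Fin 2) (Fin 2) ℂ),
      (∀ i, 0 ≤ p i) ∧ (∀ i, IsState (α i)) ∧ (∀ i, IsState (β i)) ∧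
      ρ = ∑ i, (p i : ℂ) • (α i ⊗ₖ β i) := by
    clear htr
    induction h using AddSubmonoid.closure_induction with
    | mem x hx =>
      obtain ⟨α, β, hα, hβ, rfl⟩ := hx
      obtain ⟨p, σ, hp, hσ, rfl⟩ := exists_normalization hα
      obtain ⟨q, τ, hq, hτ, rfl⟩ := exists_normalization hβ
      refine ⟨1, fun _ => p * q, fun _ => σ, fun _ => τ, fun _ => mul_nonneg hp hq, fun _ => hσ,
        fun _ => hτ, ?_⟩
      simp only [Finset.univ_unique, Finset.sum_singleton, smul_kronecker, kronecker_smul, smul_smul,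
        Complex.ofReal_mul, mul_comm (q : ℂ)]
    | zero => exact ⟨0, Fin.elim0, Fin.elim0, Fin.elim0, fun i => i.elim0, fun i => i.elim0,
        fun i => i.elim0, by simp⟩
    | add x y _ _ hx hy =>
      obtain ⟨N, p, α, β, hp, hα, hβ, rfl⟩ := hx
      obtain ⟨N', p', α', β', hp', hα', hβ', rfl⟩ := hy
      refine ⟨N + N', Fin.append p p', Fin.append α α', Fin.append β β', ?_, ?_, ?_, ?_⟩
      · intro i; refine Fin.addCases (fun i => ?_) (fun i => ?_) i <;> simp [hp, hp']
      · intro i; refine Fin.addCases (fun i => ?_) (fun i => ?_) i <;> simp [hα, hα']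
      · intro i; refine Fin.addCases (fun i => ?_) (fun i => ?_) i <;> simp [hβ, hβ']
      · rw [Fin.sum_univ_add]; simp
  obtain ⟨N, p, α, β, hp, hα, hβ, rfl⟩ := key
  refine ⟨N, p, α, β, hp, ?_, hα, hβ, rfl⟩
  rw [trace_sum] at htr
  simp only [trace_smul, trace_kronecker, (hα _).2, (hβ _).2] at htr
  have : ((∑ i, p i : ℝ) : ℂ) = 1 := by simpa using htr
  exact_mod_cast this

/-- Such a matrix lives on |1⟩ ⊗ ℂ², so it is a single product. -/
lemma mem_sepCone_of_supported {σ : Op} (hσ : σ.PosSemidef) (h0 : ∀ x, σ x (0, 0) = 0)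
    (h1 : ∀ x, σ x (0, 1) = 0) : σ ∈ sepCone := by
  have h0' : ∀ x, σ (0, 0) x = 0 := fun x => by rw [← hσ.1.apply, h0, star_zero]
  have h1' : ∀ x, σ (0, 1) x = 0 := fun x => by rw [← hσ.1.apply, h1, star_zero]
  have : σ = proj ![0, 1] ⊗ₖ σ.submatrix (fun b => (1, b)) (fun b => (1, b)) := by
    ext ⟨a, b⟩ ⟨c, d⟩
    fin_cases a <;> fin_cases c <;> fin_cases b <;> fin_cases d <;>
      simp [proj_apply, h0, h1, h0', h1']
  rw [this]
  exact kronecker_mem_sepCone (posSemidef_proj _) (hσ.submatrix _)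

/-- Normal form of the case in which ρ and ρ^Γ annihilate matching product vectors. The column ρ|01⟩
is then a product x ⊗ |1⟩, and splitting off its projector leaves a remainder that annihilates |00⟩
and |01⟩. -/
lemma mem_sepCone_of_ker_ket00 {ρ : Op} (hρ : ρ.PosSemidef) (h0 : ∀ x, ρ x (0, 0) = 0)
    (h1 : ρ (1, 0) (0, 1) = 0) : ρ ∈ sepCone := by
  have h0' : ∀ x, ρ (0, 0) x = 0 := fun x => by rw [← hρ.1.apply, h0, star_zero]
  set u : Fin 2 × Fin 2 → ℂ := Pi.single (0, 1) 1 with hu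
  have hcol : ∀ x, (ρ *ᵥ u) x = ρ x (0, 1) := fun x => by simp [hu]
  by_cases hz : ρ *ᵥ u = 0
  · exact mem_sepCone_of_supported hρ h0 fun x => by rw [← hcol, hz, Pi.zero_apply]
  have hs := sesq_pos_of_mulVec_ne_zero hρ hz
  set s := (sesq ρ u u).re
  have hp : ρ *ᵥ u = prodVec ![ρ (0, 1) (0, 1), ρ (1, 1) (0, 1)] ![0, 1] := by
    ext ⟨a, b⟩
    rw [hcol]
    fin_cases a <;> fin_cases b <;> simp [prodVec, h0', h1]
  have hP : (ρ - ((s⁻¹ : ℝ) : ℂ) • proj (ρ *ᵥ u)).PosSemidef :=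
    posSemidef_sub_proj hρ u (inv_nonneg.mpr hs.le) (inv_mul_cancel₀ hs.ne').le
  have hQ : (ρ - ((s⁻¹ : ℝ) : ℂ) • proj (ρ *ᵥ u)) *ᵥ u = 0 := by
    rw [sub_proj_mulVec hρ.1, sesq_self_eq_re hρ.1, ← Complex.ofReal_mul, inv_mul_cancel₀ hs.ne']
    simp
  have hR : ρ - ((s⁻¹ : ℝ) : ℂ) • proj (ρ *ᵥ u) ∈ sepCone := by
    refine mem_sepCone_of_supported hP (fun x => ?_) fun x => ?_
    · simp [h0, proj, vecMulVec_apply, hcol, h0']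
    · simpa [hu] using congrFun hQ x
  rw [← sub_add_cancel ρ (((s⁻¹ : ℝ) : ℂ) • proj (ρ *ᵥ u))]
  refine add_mem hR ?_
  rw [hp]
  exact smul_proj_mem_sepCone _ _ (inv_nonneg.mpr hs.le)

/-- A matrix with orthogonal columns, the first of which is `e`. -/
def frame (e : Fin 2 → ℂ) : Matrix (Fin 2) (Fin 2) ℂ := !![e 0, -star (e 1); e 1, star (e 0)]

lemma isUnit_det_frame {e : Fin 2 → ℂ} (he : e ≠ 0) : IsUnit (frame e).det := by
  rw [isUnit_iff_ne_zero, frame, det_fin_two_of]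
  intro h
  apply he
  have h2 : ((Complex.normSq (e 0) + Complex.normSq (e 1) : ℝ) : ℂ) = 0 := by
    push_cast
    rw [← Complex.mul_conj, ← Complex.mul_conj, ← h]
    simp only [Complex.star_def]
    ring
  have h3 : Complex.normSq (e 0) + Complex.normSq (e 1) = 0 := by exact_mod_cast h2
  have h4 := Complex.normSq_nonneg (e 0)
  have h5 := Complex.normSq_nonneg (e 1)
  have h6 : e 0 = 0 := Complex.normSq_eq_zero.mp (by linarith)
  have h7 : e 1 = 0 := Complex.normSq_eq_zero.mp (by linarith)
  ext i
  fin_cases i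
  · exact h6
  · exact h7

lemma frame_mulVec (e : Fin 2 → ℂ) : frame e *ᵥ ![1, 0] = e := by
  ext i
  fin_cases i <;> simp [frame, mulVec, dotProduct]

lemma frame_map_star_mulVec (e : Fin 2 → ℂ) : (frame e).map star *ᵥ ![1, 0] = star e := by
  ext i
  fin_cases i <;> simp [frame, mulVec, dotProduct]

/-- A positive semidefinite matrix that annihilates a product vector `e ⊗ f`, and whose partial
transpose annihilates `e ⊗ f̄`, is separable. -/
lemma mem_sepCone_of_ker_prodVec {ρ : Op} (hρ : ρ.PosSemidef) {e f : Fin 2 → ℂ} (he : e ≠ 0)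
    (hf : f ≠ 0) (h : ρ *ᵥ prodVec e f = 0) (h' : pt ρ *ᵥ prodVec e (star f) = 0) :
    ρ ∈ sepCone := by
  set S := frame e
  set T := frame f
  have hS : S * S⁻¹ = 1 := Matrix.mul_nonsing_inv _ (isUnit_det_frame he)
  have hT : T * T⁻¹ = 1 := Matrix.mul_nonsing_inv _ (isUnit_det_frame hf)
  -- This invertible local filter moves e ⊗ f to |00⟩; `conj_mem_sepCone` allows it to be undone at
  -- the end.
  set σ : Op := (Sᴴ ⊗ₖ Tᴴ) * ρ * (Sᴴ ⊗ₖ Tᴴ)ᴴ with hσ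
  have e00 : (Pi.single (0, 0) 1 : Fin 2 × Fin 2 → ℂ) = prodVec ![1, 0] ![1, 0] := by
    ext ⟨a, b⟩
    fin_cases a <;> fin_cases b <;> simp [prodVec]
  have h1 : σ *ᵥ Pi.single (0, 0) 1 = 0 := by
    rw [e00, hσ, ← mulVec_mulVec, ← mulVec_mulVec, conjTranspose_kronecker,
      conjTranspose_conjTranspose, conjTranspose_conjTranspose, kronecker_mulVec_prodVec,
      frame_mulVec, frame_mulVec, h, mulVec_zero]
  have h2 : pt σ *ᵥ Pi.single (0, 0) 1 = 0 := by
    have hm : (Tᴴ.map star)ᴴ = T.map star := by ext; simp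
    rw [e00, hσ, pt_conj, ← mulVec_mulVec, ← mulVec_mulVec, conjTranspose_kronecker,
      conjTranspose_conjTranspose, hm, kronecker_mulVec_prodVec,
      frame_mulVec, frame_map_star_mulVec, h', mulVec_zero]
  have h3 : σ ∈ sepCone := by
    refine mem_sepCone_of_ker_ket00 (hρ.mul_mul_conjTranspose_same _) (fun x => ?_) ?_
    · simpa using congrFun h1 x
    · simpa [pt_apply] using congrFun h2 (1, 1)
  have h4 : ρ = ((S⁻¹)ᴴ ⊗ₖ (T⁻¹)ᴴ) * σ * ((S⁻¹)ᴴ ⊗ₖ (T⁻¹)ᴴ)ᴴ := by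
    have hS' : (S⁻¹)ᴴ * Sᴴ = 1 := by rw [← conjTranspose_mul, hS, conjTranspose_one]
    have hT' : (T⁻¹)ᴴ * Tᴴ = 1 := by rw [← conjTranspose_mul, hT, conjTranspose_one]
    have hl : ((S⁻¹)ᴴ ⊗ₖ (T⁻¹)ᴴ) * (Sᴴ ⊗ₖ Tᴴ) = 1 := by
      rw [← mul_kronecker_mul, hS', hT', one_kronecker_one]
    have hr : (Sᴴ ⊗ₖ Tᴴ)ᴴ * ((S⁻¹)ᴴ ⊗ₖ (T⁻¹)ᴴ)ᴴ = 1 := by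
      rw [← conjTranspose_mul, hl, conjTranspose_one]
    calc ρ = (((S⁻¹)ᴴ ⊗ₖ (T⁻¹)ᴴ) * (Sᴴ ⊗ₖ Tᴴ)) * ρ * ((Sᴴ ⊗ₖ Tᴴ)ᴴ * ((S⁻¹)ᴴ ⊗ₖ (T⁻¹)ᴴ)ᴴ) := by
          rw [hl, hr, one_mul, mul_one]
      _ = _ := by rw [hσ]; simp only [Matrix.mul_assoc]
  rw [h4]
  exact conj_mem_sepCone _ _ h3

/-- If `tr (τ M) = 0` for a nonzero positive semidefinite `τ`, then `0` is in the numerical range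
of the qubit operator `M`. -/
lemma exists_sesq_eq_zero {τ M : Matrix (Fin 2) (Fin 2) ℂ} (hτ : τ.PosSemidef) (hτ0 : τ ≠ 0)
    (h : (M * τ).trace = 0) : ∃ e, e ≠ 0 ∧ sesq M e e = 0 := by
  obtain ⟨x, y, hxy⟩ : ∃ x y : Fin 2 → ℂ, τ = proj x + proj y := by
    obtain ⟨B, hB⟩ := exists_eq_mul_conjTranspose hτ
    refine ⟨fun i => B i 0, fun i => B i 1, ?_⟩
    rw [hB]
    ext i j
    simp [Matrix.mul_apply, proj_apply]
  rw [hxy, mul_add, trace_add, trace_mul_proj, trace_mul_proj] at h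
  set μ := sesq M x x with hμ
  have hy : sesq M y y = -μ := eq_neg_of_add_eq_zero_right h
  by_cases hμ0 : μ = 0
  · by_cases hx0 : x = 0
    · refine ⟨y, ?_, by rw [hy, hμ0, neg_zero]⟩
      rintro rfl
      exact hτ0 (by simp [hxy, hx0, proj])
    · exact ⟨x, hx0, hμ0⟩
  set P := sesq M x y / μ with hP
  set Q := sesq M y x / μ with hQ
  have hP' : sesq M x y = P * μ := by rw [hP, div_mul_cancel₀ _ hμ0]
  have hQ' : sesq M y x = Q * μ := by rw [hQ, div_mul_cancel₀ _ hμ0]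
  -- At a x + z y with a real, the form is μ(a² + a(zP + z̄Q) - |z|²). A z that makes the middle
  -- coefficient real leaves a real quadratic in a with nonnegative discriminant.
  obtain ⟨z, hz0, hz⟩ : ∃ z : ℂ, z ≠ 0 ∧ (z * P + star z * Q).im = 0 := by
    by_cases hPQ : P - star Q = 0
    · refine ⟨1, one_ne_zero, ?_⟩
      rw [sub_eq_zero.mp hPQ]
      simp
    · refine ⟨star (P - star Q), star_ne_zero.mpr hPQ, ?_⟩
      simp
      ring
  set r := (z * P + star z * Q).re with hr
  have hr' : z * P + star z * Q = (r : ℂ) := Complex.ext (by rw [Complex.ofReal_re]) (by rw [hz, Complex.ofReal_im])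
  have hn : 0 < Complex.normSq z := Complex.normSq_pos.mpr hz0
  obtain ⟨a, ha⟩ : ∃ a : ℝ, a * a + a * r - Complex.normSq z = 0 := by
    have hd : 0 ≤ r ^ 2 + 4 * Complex.normSq z := by positivity
    refine ⟨(-r + √(r ^ 2 + 4 * Complex.normSq z)) / 2, ?_⟩
    have := Real.mul_self_sqrt hd
    linarith
  have hzz : z * star z = (Complex.normSq z : ℂ) := Complex.mul_conj z
  have ha' : (a : ℂ) * a + a * r - Complex.normSq z = 0 := by exact_mod_cast ha
  refine ⟨(a : ℂ) • x + z • y, fun h0 => ?_, ?_⟩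
  -- If the combination vanished, the form would take the values -|z|²μ and a²μ at one and the same
  -- vector.
  · have h1 : z • y = (-(a : ℂ)) • x := by
      rw [neg_smul]; exact eq_neg_of_add_eq_zero_right h0
    have h2 : sesq M (z • y) (z • y) = sesq M ((-(a : ℂ)) • x) ((-(a : ℂ)) • x) := by rw [h1]
    simp only [sesq_smul_left, sesq_smul_right, hy, ← hμ] at h2
    have h3 : ((Complex.normSq z + a * a : ℝ) : ℂ) * μ = 0 := by
      push_cast
      rw [← hzz]
      simp only [star_neg, Complex.star_def, Complex.conj_ofReal] at h2 ⊢
      linear_combination -h2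
    have h4 : Complex.normSq z + a * a = 0 := by
      exact_mod_cast (mul_eq_zero.mp h3).resolve_right hμ0
    nlinarith
  · simp only [sesq_add_left, sesq_add_right, sesq_smul_left, sesq_smul_right, hy, ← hμ, hP', hQ',
      Complex.star_def, Complex.conj_ofReal] at *
    linear_combination μ * ha' - μ * hzz + (a : ℂ) * μ * hr'

end PeresHorodecki

lemma posSemidef_leftMarginal {ρ : Op} (hρ : ρ.PosSemidef) :
    (Matrix.of fun a c => ρ (a, 0) (c, 0) + ρ (a, 1) (c, 1)).PosSemidef :=
  (hρ.submatrix fun a => (a, 0)).add (hρ.submatrix fun a => (a, 1))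

/-- If neither `ρ` nor its partial transpose annihilates a product vector, there is a product
vector `e ⊗ f` in the range of `ρ` with `e ⊗ f̄` in the range of the partial transpose. -/
lemma exists_prodVec_mem_ranges {ρ : Op} (hρ : ρ.PosSemidef) (hΓ : (pt ρ).PosSemidef)
    (h1 : ∀ e f, e ≠ 0 → f ≠ 0 → ρ *ᵥ prodVec e f ≠ 0)
    (h2 : ∀ e f, e ≠ 0 → f ≠ 0 → pt ρ *ᵥ prodVec e f ≠ 0) :
    ∃ e f, e ≠ 0 ∧ f ≠ 0 ∧ (∃ u, ρ *ᵥ u = prodVec e f) ∧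
      ∃ u, pt ρ *ᵥ u = prodVec e (star f) := by
  obtain ⟨k, hk, hk'⟩ := exists_ker_le_span h1
  obtain ⟨h, hh, hh'⟩ := exists_ker_le_span h2
  -- The kernels are spanned by k and h, so lying in the ranges amounts to one orthogonality
  -- condition each.
  suffices H : ∃ e f, e ≠ 0 ∧ f ≠ 0 ∧ star k ⬝ᵥ prodVec e f = 0 ∧
      star h ⬝ᵥ prodVec e (star f) = 0 by
    obtain ⟨e, f, he, hf, hke, hhe⟩ := H
    refine ⟨e, f, he, hf, exists_mulVec_eq hρ.1 fun x hx => ?_,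
      exists_mulVec_eq hΓ.1 fun x hx => ?_⟩
    · obtain ⟨c, rfl⟩ := hk' x hx
      rw [star_smul, smul_dotProduct, hke, smul_zero]
    · obtain ⟨c, rfl⟩ := hh' x hx
      rw [star_smul, smul_dotProduct, hhe, smul_zero]
  have e0 : (![1, 0] : Fin 2 → ℂ) ≠ 0 := by simp
  by_cases hk0 : k = 0
  · obtain ⟨f, hf, hf'⟩ := exists_ne_zero_annihilator (star (h (0, 0))) (star (h (0, 1)))
    refine ⟨![1, 0], star f, e0, star_ne_zero.mpr hf, by simp [hk0], ?_⟩
    rw [star_star]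
    simpa [dotProduct, prodVec, Fintype.sum_prod_type] using hf'
  by_cases hh0 : h = 0
  · obtain ⟨f, hf, hf'⟩ := exists_ne_zero_annihilator (star (k (0, 0))) (star (k (0, 1)))
    refine ⟨![1, 0], f, e0, hf, ?_, by simp [hh0]⟩
    simpa [dotProduct, prodVec, Fintype.sum_prod_type] using hf'
  have hdet : k (0, 0) * k (1, 1) - k (0, 1) * k (1, 0) ≠ 0 := fun hd => by
    obtain ⟨e, f, hef⟩ := exists_eq_prodVec (sub_eq_zero.mp hd)
    rw [hef] at hk0 hk
    exact h1 e f (left_ne_zero_of_prodVec hk0) (right_ne_zero_of_prodVec hk0) hk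
  set τ : Matrix (Fin 2) (Fin 2) ℂ := Matrix.of fun a c => ρ (a, 0) (c, 0) + ρ (a, 1) (c, 1)
    with hτ
  -- For given e, the f chosen below solves the condition on k identically; the condition on h then
  -- reads ⟨e|M|e⟩ = 0.
  set M : Matrix (Fin 2) (Fin 2) ℂ :=
    Matrix.of fun c a => star (h (a, 0)) * k (c, 1) - star (h (a, 1)) * k (c, 0) with hM
  have hτ0 : τ ≠ 0 := fun h0 => by
    have : ρ.trace = 0 := by
      have := congrArg Matrix.trace h0
      simp only [Matrix.trace, Matrix.diag, hτ, Fin.sum_univ_two, Matrix.of_apply,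
        Matrix.zero_apply, Fintype.sum_prod_type] at this ⊢
      simpa using this
    rw [hρ.trace_eq_zero_iff] at this
    exact h1 _ _ e0 e0 (by rw [this, zero_mulVec])
  -- With τ the marginal of Alice, this is a combination of the entries of ρk = 0 and of h†ρ^Γ = 0.
  -- It makes the numerical range of M contain 0.
  have htr : (M * τ).trace = 0 := by
    have Hk : ∀ x, ρ x (0, 0) * k (0, 0) + ρ x (0, 1) * k (0, 1) + (ρ x (1, 0) * k (1, 0) +
        ρ x (1, 1) * k (1, 1)) = 0 := fun x => by
      simpa [mulVec, dotProduct, Fintype.sum_prod_type] using congrFun hk x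
    have Hh : ∀ c d, star (h (0, 0)) * ρ (0, d) (c, 0) + star (h (0, 1)) * ρ (0, d) (c, 1) +
        (star (h (1, 0)) * ρ (1, d) (c, 0) + star (h (1, 1)) * ρ (1, d) (c, 1)) = 0 := fun c d => by
      have := congrArg star (congrFun hh (c, d))
      simpa only [mulVec, dotProduct, Fintype.sum_prod_type, Fin.sum_univ_two, star_add, star_mul',
        pt_apply, hρ.1.apply, Pi.zero_apply, star_zero, mul_comm (star (h _))] using this
    simp only [Matrix.trace, Matrix.diag, Matrix.mul_apply, hM, hτ, Matrix.of_apply,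
      Fin.sum_univ_two]
    linear_combination -star (h (0, 1)) * Hk (0, 0) + star (h (0, 0)) * Hk (0, 1)
      - star (h (1, 1)) * Hk (1, 0) + star (h (1, 0)) * Hk (1, 1)
      + k (0, 1) * Hh 0 0 - k (0, 0) * Hh 0 1 + k (1, 1) * Hh 1 0 - k (1, 0) * Hh 1 1
  obtain ⟨e, he, hMe⟩ := exists_sesq_eq_zero (posSemidef_leftMarginal hρ) hτ0 htr
  -- This f is nonzero because k is not a product vector, i.e. has nonzero determinant.
  refine ⟨e, ![star (k (0, 1)) * e 0 + star (k (1, 1)) * e 1,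
    -(star (k (0, 0)) * e 0 + star (k (1, 0)) * e 1)], he, fun h0 => he ?_, ?_, ?_⟩
  · have h3 := congrFun h0 0
    have h4 := congrFun h0 1
    simp only [cons_val_zero, cons_val_one, Pi.zero_apply, neg_eq_zero] at h3 h4
    have hd' : star (k (0, 0) * k (1, 1) - k (0, 1) * k (1, 0)) ≠ 0 := star_ne_zero.mpr hdet
    simp only [star_sub, star_mul'] at hd'
    have h5 : (star (k (0, 0)) * star (k (1, 1)) - star (k (0, 1)) * star (k (1, 0))) * e 0 = 0 := by
      linear_combination star (k (1, 1)) * h4 - star (k (1, 0)) * h3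
    have h6 : (star (k (0, 0)) * star (k (1, 1)) - star (k (0, 1)) * star (k (1, 0))) * e 1 = 0 := by
      linear_combination star (k (0, 0)) * h3 - star (k (0, 1)) * h4
    replace h5 := (mul_eq_zero.mp h5).resolve_left hd'
    replace h6 := (mul_eq_zero.mp h6).resolve_left hd'
    ext i
    fin_cases i
    · exact h5
    · exact h6
  · simp [dotProduct, prodVec, Fintype.sum_prod_type]
    ring
  · rw [sesq] at hMe
    simp [dotProduct, prodVec, Fintype.sum_prod_type, mulVec, hM] at hMe ⊢
    linear_combination hMe

/-- The Peres–Horodecki theorem for two qubits: positive partial transpose implies separability. -/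
lemma mem_sepCone_of_pt_posSemidef {ρ : Op} (hρ : ρ.PosSemidef) (hΓ : (pt ρ).PosSemidef) :
    ρ ∈ sepCone := by
  induction hr : ρ.rank + (pt ρ).rank using Nat.strong_induction_on generalizing ρ with
  | _ r ih =>
  by_cases h1 : ∀ e f, e ≠ 0 → f ≠ 0 → ρ *ᵥ prodVec e f ≠ 0
  swap
  · push Not at h1
    obtain ⟨e, f, he, hf, h⟩ := h1
    refine mem_sepCone_of_ker_prodVec hρ he hf h (mulVec_eq_zero_of_sesq hΓ ?_)
    rw [sesq_pt_prodVec, star_star, sesq, h, dotProduct_zero, Complex.zero_re]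
  by_cases h2 : ∀ e f, e ≠ 0 → f ≠ 0 → pt ρ *ᵥ prodVec e f ≠ 0
  swap
  · push Not at h2
    obtain ⟨e, f, he, hf, h⟩ := h2
    rw [← pt_pt ρ]
    refine pt_mem_sepCone (mem_sepCone_of_ker_prodVec hΓ he hf h
      (mulVec_eq_zero_of_sesq hρ ?_))
    change (sesq (pt (pt ρ)) _ _).re = 0
    rw [sesq_pt_prodVec, star_star, sesq, h, dotProduct_zero, Complex.zero_re]
  obtain ⟨e, f, he, hf, ⟨u, hu⟩, v, hv⟩ := exists_prodVec_mem_ranges hρ hΓ h1 h2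
  have hu0 : ρ *ᵥ u ≠ 0 := hu ▸ prodVec_ne_zero he hf
  have hv0 : pt ρ *ᵥ v ≠ 0 := hv ▸ prodVec_ne_zero he (star_ne_zero.mpr hf)
  have hs := sesq_pos_of_mulVec_ne_zero hρ hu0
  have hs' := sesq_pos_of_mulVec_ne_zero hΓ hv0
  have hpt : ∀ t : ℝ, pt (ρ - (t : ℂ) • proj (ρ *ᵥ u)) = pt ρ - (t : ℂ) • proj (pt ρ *ᵥ v) := by
    intro t
    rw [pt_sub, pt_smul, hu, hv, proj_prodVec, proj_prodVec, pt_kronecker]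
    congr 3
    ext i j
    simp [proj_apply, mul_comm]
  -- The largest multiple that keeps both ρ and ρ^Γ positive; the constraint that becomes tight
  -- lowers the corresponding rank.
  obtain ⟨t, ht0, ht1, ht2, ht⟩ : ∃ t : ℝ, 0 ≤ t ∧ t * (sesq ρ u u).re ≤ 1 ∧
      t * (sesq (pt ρ) v v).re ≤ 1 ∧
      (t * (sesq ρ u u).re = 1 ∨ t * (sesq (pt ρ) v v).re = 1) := by
    rcases le_total (sesq ρ u u).re (sesq (pt ρ) v v).re with hle | hle
    · refine ⟨(sesq (pt ρ) v v).re⁻¹, inv_nonneg.mpr hs'.le, ?_, ?_, Or.inr ?_⟩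
      · rw [inv_mul_le_iff₀ hs', mul_one]; exact hle
      · exact (inv_mul_cancel₀ hs'.ne').le
      · exact inv_mul_cancel₀ hs'.ne'
    · refine ⟨(sesq ρ u u).re⁻¹, inv_nonneg.mpr hs.le, ?_, ?_, Or.inl ?_⟩
      · exact (inv_mul_cancel₀ hs.ne').le
      · rw [inv_mul_le_iff₀ hs, mul_one]; exact hle
      · exact inv_mul_cancel₀ hs.ne'
  have hP := posSemidef_sub_proj hρ u ht0 ht1
  have hQ := posSemidef_sub_proj hΓ v ht0 ht2
  have hlt : (ρ - (t : ℂ) • proj (ρ *ᵥ u)).rank + (pt (ρ - (t : ℂ) • proj (ρ *ᵥ u))).rank < r := by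
    rw [hpt, ← hr]
    rcases ht with ht | ht
    · exact add_lt_add_of_lt_of_le (rank_sub_proj_lt hρ hu0 ht) (rank_sub_proj_le hΓ.1 v t)
    · exact add_lt_add_of_le_of_lt (rank_sub_proj_le hρ.1 u t) (rank_sub_proj_lt hΓ hv0 ht)
  have := ih _ hlt hP (by rw [hpt]; exact hQ) rfl
  rw [← sub_add_cancel ρ ((t : ℂ) • proj (ρ *ᵥ u))]
  refine add_mem this ?_
  rw [hu]
  exact smul_proj_mem_sepCone _ _ ht0

/-! ### Geometry of the feasible set. -/

section Feasible

/-- The squared Euclidean norm of a vector. -/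
def nsq {n : Type*} [Fintype n] (v : n → ℂ) : ℝ := ∑ i, Complex.normSq (v i)

lemma nsq_nonneg {n : Type*} [Fintype n] (v : n → ℂ) : 0 ≤ nsq v :=
  Finset.sum_nonneg fun _ _ => Complex.normSq_nonneg _

lemma star_dotProduct_self {n : Type*} [Fintype n] (v : n → ℂ) : star v ⬝ᵥ v = (nsq v : ℂ) := by
  simp [dotProduct, nsq, Complex.normSq_eq_conj_mul_self]

lemma nsq_star {n : Type*} [Fintype n] (v : n → ℂ) : nsq (star v) = nsq v := by
  simp [nsq]

lemma nsq_smul {n : Type*} [Fintype n] (c : ℂ) (v : n → ℂ) :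
    nsq (c • v) = Complex.normSq c * nsq v := by
  simp [nsq, Finset.mul_sum]

lemma nsq_prodVec (e f : Fin 2 → ℂ) : nsq (prodVec e f) = nsq e * nsq f := by
  simp [nsq, prodVec, Fintype.sum_prod_type]
  ring

lemma sesq_one_re {n : Type*} [Fintype n] [DecidableEq n] (v : n → ℂ) :
    (sesq 1 v v).re = nsq v := by
  rw [sesq_one, star_dotProduct_self, Complex.ofReal_re]

lemma isHermitian_half : ((1 / 2 : ℂ) • (1 : Op)).IsHermitian := by
  simp [IsHermitian]

lemma sesq_half_re (v : Fin 2 × Fin 2 → ℂ) :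
    (sesq ((1 / 2 : ℂ) • (1 : Op)) v v).re = nsq v / 2 := by
  rw [sesq_smul_mat, sesq_one, star_dotProduct_self, ← Complex.ofReal_one, ← Complex.ofReal_ofNat,
    ← Complex.ofReal_div, ← Complex.ofReal_mul, Complex.ofReal_re]
  ring

lemma half_sub_pt_posSemidef_iff {X : Op} (hX : X.IsHermitian) :
    ((1 / 2 : ℂ) • (1 : Op) - pt X).PosSemidef ↔ ∀ v, (sesq (pt X) v v).re ≤ nsq v / 2 := by
  constructor
  · intro h v
    have := sesq_self_re_nonneg h v
    rw [sesq_sub_mat, Complex.sub_re, sesq_half_re] at this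
    linarith
  · intro h
    refine posSemidef_of_sesq (isHermitian_half.sub (pt_isHermitian hX)) fun v => ?_
    rw [sesq_sub_mat, Complex.sub_re, sesq_half_re]
    linarith [h v]

lemma sesq_prodVec_le {X : Op} (hX : X.IsHermitian)
    (h : ((1 / 2 : ℂ) • (1 : Op) - pt X).PosSemidef) (e f : Fin 2 → ℂ) :
    (sesq X (prodVec e f) (prodVec e f)).re ≤ nsq e * nsq f / 2 := by
  have := (half_sub_pt_posSemidef_iff hX).mp h (prodVec e (star f))
  rwa [sesq_pt_prodVec, star_star, nsq_prodVec, nsq_star] at this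

/-- For a positive semidefinite matrix of two qubits, the upper bound `1/2` on the partial
transpose implies the lower bound `-1/2`. -/
lemma pt_add_half_posSemidef {X : Op} (hX : X.PosSemidef)
    (h : ((1 / 2 : ℂ) • (1 : Op) - pt X).PosSemidef) :
    (pt X + (1 / 2 : ℂ) • (1 : Op)).PosSemidef := by
  refine posSemidef_of_sesq ((pt_isHermitian hX.1).add isHermitian_half) fun v => ?_
  rw [sesq_add_mat, Complex.add_re, sesq_half_re]
  -- For v = |0⟩f₀ + |1⟩f₁ the diagonal terms of X^Γ are nonnegative. Its cross terms are those of X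
  -- at |0⟩f̄₁ + |1⟩f̄₀, where positivity of X and the bound 1/2 on product vectors limit how
  -- negative they are.
  set f₀ : Fin 2 → ℂ := fun b => v (0, b) with hf₀
  set f₁ : Fin 2 → ℂ := fun b => v (1, b) with hf₁
  set e₀ : Fin 2 → ℂ := ![1, 0] with he₀
  set e₁ : Fin 2 → ℂ := ![0, 1] with he₁
  have hv : v = prodVec e₀ f₀ + prodVec e₁ f₁ := by
    ext ⟨a, b⟩
    fin_cases a <;> simp [prodVec, he₀, he₁, hf₀, hf₁]
  have hn : nsq v = nsq f₀ + nsq f₁ := by simp [nsq, Fintype.sum_prod_type, hf₀, hf₁]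
  have ha := sesq_prodVec_le hX.1 h e₀ (star f₁)
  have hb := sesq_prodVec_le hX.1 h e₁ (star f₀)
  have n0 : nsq e₀ = 1 := by simp [nsq, he₀]
  have n1 : nsq e₁ = 1 := by simp [nsq, he₁]
  rw [n0, nsq_star] at ha
  rw [n1, nsq_star] at hb
  have hab := sesq_self_re_nonneg hX (prodVec e₀ (star f₁) + prodVec e₁ (star f₀))
  have h00 := sesq_self_re_nonneg hX (prodVec e₀ (star f₀))
  have h11 := sesq_self_re_nonneg hX (prodVec e₁ (star f₁))
  rw [hn, hv]
  simp only [sesq_add_left, sesq_add_right, sesq_pt_prodVec, Complex.add_re] at hab ⊢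
  linarith

/-- Two of the four constraints are redundant: the lower bound on X^Γ follows from the other two,
and X ≤ 1 is the same fact applied to 1/2 - X^Γ. -/
lemma isFeasible_iff {X : Op} :
    IsFeasible X ↔ X.PosSemidef ∧ ((1 / 2 : ℂ) • (1 : Op) - pt X).PosSemidef := by
  constructor
  · exact fun h => ⟨h.1, h.2.2.2⟩
  · rintro ⟨h1, h2⟩
    have h3 : ((1 / 2 : ℂ) • (1 : Op) - pt ((1 / 2 : ℂ) • (1 : Op) - pt X)) = X := by
      rw [pt_sub, pt_smul, pt_one, pt_pt, sub_sub_cancel]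
    refine ⟨h1, ?_, pt_add_half_posSemidef h1 h2, h2⟩
    have h4 := pt_add_half_posSemidef h2 (by rw [h3]; exact h1)
    convert h4 using 1
    rw [pt_sub, pt_smul, pt_one, pt_pt]
    module

/-- The involution Y ↦ 1/2 - Y^Γ exchanges the two essential constraints. It converts overlaps
tr(Yρ) into values of the objective. -/
lemma isFeasible_half_sub_pt {Y : Op} (h : IsFeasible Y) :
    IsFeasible ((1 / 2 : ℂ) • (1 : Op) - pt Y) := by
  rw [isFeasible_iff] at h ⊢
  refine ⟨h.2, ?_⟩
  rw [pt_sub, pt_smul, pt_one, pt_pt, sub_sub_cancel]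
  exact h.1

/-- The vector `(A ⊗ I)|ψ⟩`. -/
def vecOf (A : Matrix (Fin 2) (Fin 2) ℂ) : Fin 2 × Fin 2 → ℂ :=
  fun x => ((1 / √2 : ℝ) : ℂ) * A x.1 x.2

lemma kronecker_one_mulVec_psi (A : Matrix (Fin 2) (Fin 2) ℂ) :
    (A ⊗ₖ (1 : Matrix (Fin 2) (Fin 2) ℂ)) *ᵥ psi = vecOf A := by
  ext ⟨a, b⟩
  fin_cases b <;>
    simp [mulVec, dotProduct, Fintype.sum_prod_type, psi, vecOf, mul_comm]

lemma rankOneOp_eq_proj (A : Matrix (Fin 2) (Fin 2) ℂ) : rankOneOp A = proj (vecOf A) := by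
  rw [← kronecker_one_mulVec_psi, rankOneOp, proj, proj, mul_vecMulVec, vecMulVec_mul, star_mulVec,
    conjTranspose_kronecker, conjTranspose_one]

lemma inv_sqrt_two_sq : (1 / √2 : ℝ) * (1 / √2 : ℝ) = 1 / 2 := by
  rw [div_mul_div_comm, one_mul, Real.mul_self_sqrt (by norm_num)]

lemma exists_eq_vecOf (a : Fin 2 × Fin 2 → ℂ) : ∃ A, a = vecOf A := by
  refine ⟨Matrix.of fun i j => ((√2 : ℝ) : ℂ) * a (i, j), ?_⟩
  ext ⟨i, j⟩
  have : (√2 : ℝ) ≠ 0 := by positivity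
  have : ((1 / √2 : ℝ) : ℂ) * ((√2 : ℝ) : ℂ) = 1 := by
    rw [← Complex.ofReal_mul, one_div_mul_cancel this, Complex.ofReal_one]
  simp only [vecOf, Matrix.of_apply]
  rw [← mul_assoc, this, one_mul]

lemma one_sub_conjTranspose_mul_self_posSemidef_iff {A : Matrix (Fin 2) (Fin 2) ℂ} :
    (1 - Aᴴ * A).PosSemidef ↔ ∀ f, nsq (A *ᵥ f) ≤ nsq f := by
  have key : ∀ f, (sesq (1 - Aᴴ * A) f f).re = nsq f - nsq (A *ᵥ f) := fun f => by
    rw [sesq_sub_mat, Complex.sub_re, sesq_one_re, sesq, ← mulVec_mulVec, dotProduct_mulVec,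
      ← star_mulVec, star_dotProduct_self, Complex.ofReal_re]
  constructor
  · intro h f
    have := sesq_self_re_nonneg h f
    rw [key] at this
    linarith
  · intro h
    refine posSemidef_of_sesq (isHermitian_one.sub (isHermitian_conjTranspose_mul_self A))
      fun f => ?_
    rw [key]
    linarith [h f]

lemma star_prodVec_dotProduct_vecOf (A : Matrix (Fin 2) (Fin 2) ℂ) (e f : Fin 2 → ℂ) :
    star (prodVec e f) ⬝ᵥ vecOf A = ((1 / √2 : ℝ) : ℂ) * (star e ⬝ᵥ (A *ᵥ star f)) := by
  simp [dotProduct, prodVec, vecOf, mulVec, Fintype.sum_prod_type]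
  ring

/-- Half the swap, |ψ⟩⟨ψ|^Γ, produces the exchange of the indices a and c. -/
lemma sesq_pt_proj_vecOf (A : Matrix (Fin 2) (Fin 2) ℂ) (v : Fin 2 × Fin 2 → ℂ) :
    sesq (pt (proj (vecOf A))) v v =
      (1 / 2 : ℂ) * ∑ a, ∑ c, star ((A *ᵥ fun b => v (a, b)) c) * (A *ᵥ fun b => v (c, b)) a := by
  have h : ((1 / √2 : ℝ) : ℂ) * ((1 / √2 : ℝ) : ℂ) = 1 / 2 := by
    rw [← Complex.ofReal_mul, inv_sqrt_two_sq]; norm_num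
  rw [← h]
  simp only [sesq, dotProduct, pt_apply, proj_apply, vecOf, mulVec, Fintype.sum_prod_type,
    Fin.sum_univ_two, star_mul', star_add, Pi.star_apply, Complex.star_def, Complex.conj_ofReal]
  ring

/-- Necessity comes from testing X on the product vectors (Af) ⊗ f̄; sufficiency holds because the
swap has norm one. -/
lemma isFeasible_rankOneOp_iff {A : Matrix (Fin 2) (Fin 2) ℂ} :
    IsFeasible (rankOneOp A) ↔ (1 - Aᴴ * A).PosSemidef := by
  rw [isFeasible_iff, rankOneOp_eq_proj, one_sub_conjTranspose_mul_self_posSemidef_iff]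
  constructor
  · rintro ⟨h1, h2⟩ f
    have h := sesq_prodVec_le h1.1 h2 (A *ᵥ f) (star f)
    rw [sesq_proj_self_re, star_prodVec_dotProduct_vecOf, star_star, star_dotProduct_self,
      ← Complex.ofReal_mul, Complex.normSq_ofReal, nsq_star] at h
    have h3 := inv_sqrt_two_sq
    have h4 := nsq_nonneg (A *ᵥ f)
    have h5 : nsq (A *ᵥ f) * nsq (A *ᵥ f) ≤ nsq (A *ᵥ f) * nsq f := by
      have : 1 / √2 * nsq (A *ᵥ f) * (1 / √2 * nsq (A *ᵥ f)) =
        nsq (A *ᵥ f) * nsq (A *ᵥ f) * (1 / √2 * (1 / √2)) := by ring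
      rw [this, h3] at h
      linarith
    rcases h4.eq_or_lt with h6 | h6
    · rw [← h6]; exact nsq_nonneg f
    · exact le_of_mul_le_mul_left h5 h6
  · intro h
    refine ⟨posSemidef_proj _, (half_sub_pt_posSemidef_iff (isHermitian_proj _)).mpr fun v => ?_⟩
    rw [sesq_pt_proj_vecOf]
    have h0 := h fun b => v (0, b)
    have h1 := h fun b => v (1, b)
    have hn : nsq v = nsq (fun b => v (0, b)) + nsq (fun b => v (1, b)) := by
      simp [nsq, Fintype.sum_prod_type]
    rw [hn]
    set w₀ := A *ᵥ fun b => v (0, b)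
    set w₁ := A *ᵥ fun b => v (1, b)
    have h2 : ((1 / 2 : ℂ) * ∑ a, ∑ c, star ((A *ᵥ fun b => v (a, b)) c) *
        (A *ᵥ fun b => v (c, b)) a).re = (1 / 2) * (Complex.normSq (w₀ 0) + Complex.normSq (w₁ 1)
          + 2 * ((w₀ 1).re * (w₁ 0).re + (w₀ 1).im * (w₁ 0).im)) := by
      have h12 : (1 / 2 : ℂ) = ((1 / 2 : ℝ) : ℂ) := by norm_num
      rw [h12, Complex.re_ofReal_mul]
      simp only [Fin.sum_univ_two]
      change _ * (star (w₀ 0) * w₀ 0 + star (w₀ 1) * w₁ 0 +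
        (star (w₁ 0) * w₀ 1 + star (w₁ 1) * w₁ 1)).re = _
      simp [Complex.normSq_apply]
      ring
    rw [h2]
    simp only [nsq, Fin.sum_univ_two, Complex.normSq_apply] at h0 h1 ⊢
    nlinarith [sq_nonneg ((w₀ 1).re - (w₁ 0).re), sq_nonneg ((w₀ 1).im - (w₁ 0).im)]

end Feasible

/-! ### Existence of optimizers and reduction of their rank. -/

section Program

lemma objective_eq (ρ X : Op) : objective ρ X = 1 / 2 - (X * pt ρ).trace.re := rfl

lemma objective_proj (ρ : Op) (a : Fin 2 × Fin 2 → ℂ) :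
    objective ρ (proj a) = 1 / 2 - (sesq (pt ρ) a a).re := by
  rw [objective_eq, trace_mul_comm, trace_mul_proj]

lemma pt_proj_prodVec (e f : Fin 2 → ℂ) :
    pt (proj (prodVec e f)) = proj (prodVec e (star f)) := by
  rw [proj_prodVec, proj_prodVec, pt_kronecker]
  congr 1
  ext i j
  simp [proj_apply, mul_comm]

/-- The partial transpose of a product projector is positive, so the subtraction only relaxes X^Γ ≤
1/2. The size of t is limited by X ≥ 0 alone. -/
lemma isFeasible_sub_proj {X : Op} (hX : IsFeasible X) {u : Fin 2 × Fin 2 → ℂ}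
    {e f : Fin 2 → ℂ} (hu : X *ᵥ u = prodVec e f) {t : ℝ} (ht : 0 ≤ t)
    (hts : t * (sesq X u u).re ≤ 1) : IsFeasible (X - (t : ℂ) • proj (prodVec e f)) := by
  rw [isFeasible_iff] at hX ⊢
  refine ⟨hu ▸ posSemidef_sub_proj hX.1 u ht hts, ?_⟩
  rw [pt_sub, pt_smul, pt_proj_prodVec, sub_sub_eq_add_sub, add_sub_right_comm]
  exact hX.2.add (posSemidef_real_smul (posSemidef_proj _) ht)

lemma objective_sub_proj (ρ X : Op) (e f : Fin 2 → ℂ) (t : ℝ) :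
    objective ρ (X - (t : ℂ) • proj (prodVec e f)) =
      objective ρ X + t * (sesq ρ (prodVec e (star f)) (prodVec e (star f))).re := by
  rw [objective_eq, objective_eq, sub_mul, smul_mul_assoc, trace_sub, trace_smul, trace_mul_comm,
    trace_mul_comm (proj _), trace_mul_proj, sesq_pt_prodVec, smul_eq_mul, Complex.sub_re,
    Complex.re_ofReal_mul, trace_mul_comm]
  ring

/-- Product vectors in the range of an optimizer can be removed. -/
lemma optimal_sub_proj {ρ X : Op} (hρ : ρ.PosSemidef) (hX : IsOptimal ρ X)
    {u : Fin 2 × Fin 2 → ℂ} {e f : Fin 2 → ℂ} (hu : X *ᵥ u = prodVec e f)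
    (h0 : prodVec e f ≠ 0) :
    ρ *ᵥ prodVec e (star f) = 0 ∧ ∃ t : ℝ, 0 < t ∧
      IsOptimal ρ (X - (t : ℂ) • proj (prodVec e f)) ∧
      (X - (t : ℂ) • proj (prodVec e f)).rank < X.rank := by
  have hu0 : X *ᵥ u ≠ 0 := hu ▸ h0
  have hs := sesq_pos_of_mulVec_ne_zero hX.1.1 hu0
  have ht := inv_pos.mpr hs
  have hts := inv_mul_cancel₀ hs.ne'
  have hF := isFeasible_sub_proj hX.1 hu ht.le hts.le
  have h1 := objective_sub_proj ρ X e f (sesq X u u).re⁻¹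
  have h2 := hX.2 _ hF
  have h3 := sesq_self_re_nonneg hρ (prodVec e (star f))
  have h4 : (sesq ρ (prodVec e (star f)) (prodVec e (star f))).re = 0 := by
    refine le_antisymm (le_of_mul_le_mul_left ?_ ht) h3
    linarith
  refine ⟨mulVec_eq_zero_of_sesq hρ h4, _, ht, ⟨hF, fun Y hY => ?_⟩, ?_⟩
  · rw [h1, h4, mul_zero, add_zero]
    exact hX.2 Y hY
  · rw [← hu]
    exact rank_sub_proj_lt hX.1.1 hu0 hts

/-- The range contains a plane, and every plane contains a product vector. -/
lemma exists_prodVec_range {X : Op} (hX : X.PosSemidef) (h : ∀ a, X ≠ proj a) :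
    ∃ u e f, X *ᵥ u = prodVec e f ∧ prodVec e f ≠ 0 := by
  obtain ⟨a, ha⟩ | ⟨u, v, huv⟩ := eq_proj_or_exists_range hX
  · exact absurd ha (h a)
  obtain ⟨α, β, hαβ, e, f, hef⟩ := exists_prodVec_span (X *ᵥ u) (X *ᵥ v)
  refine ⟨α • u + β • v, e, f, by rw [mulVec_add, mulVec_smul, mulVec_smul, hef], fun h0 => ?_⟩
  obtain ⟨h1, h2⟩ := huv α β (hef.trans h0)
  simp [h1, h2] at hαβ

lemma exists_optimal_rankOneOp {ρ X : Op} (hρ : ρ.PosSemidef) (hX : IsOptimal ρ X) :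
    ∃ A, IsOptimal ρ (rankOneOp A) := by
  induction hr : X.rank using Nat.strong_induction_on generalizing X with
  | _ r ih =>
  by_cases h : ∃ a, X = proj a
  · obtain ⟨a, rfl⟩ := h
    obtain ⟨A, rfl⟩ := exists_eq_vecOf a
    exact ⟨A, by rwa [rankOneOp_eq_proj]⟩
  · push Not at h
    obtain ⟨u, e, f, hu, h0⟩ := exists_prodVec_range hX.1.1 h
    obtain ⟨-, t, -, hopt, hrank⟩ := optimal_sub_proj hρ hX hu h0
    exact ih _ (hr ▸ hrank) hopt rfl

lemma norm_apply_le_one_of_isFeasible {X : Op} (hX : IsFeasible X) (i j : Fin 2 × Fin 2) :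
    ‖X i j‖ ≤ 1 := by
  have hd : ∀ i, sesq X (Pi.single i 1) (Pi.single i 1) = X i i := fun i => by simp [sesq]
  have h1 : (X j j).re ≤ 1 := by
    have := sesq_self_re_nonneg hX.2.1 (Pi.single j 1)
    rw [sesq_sub_mat, hd, sesq_one, Complex.sub_re] at this
    simpa using this
  -- Since X_jj ≤ 1, the matrix X minus the projector on its j-th column is positive; its i-th
  -- diagonal entry gives |X_ij|² ≤ X_ii.
  have h2 := sesq_self_re_nonneg
    (posSemidef_sub_proj hX.1 (Pi.single j 1) zero_le_one (by rwa [hd, one_mul])) (Pi.single i 1)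
  have h3 : (X i i).re ≤ 1 := by
    have := sesq_self_re_nonneg hX.2.1 (Pi.single i 1)
    rw [sesq_sub_mat, hd, sesq_one, Complex.sub_re] at this
    simpa using this
  rw [Complex.ofReal_one, one_smul, sesq_sub_mat, Complex.sub_re, sesq_proj_self_re, hd] at h2
  have h4 : star (Pi.single i 1 : Fin 2 × Fin 2 → ℂ) ⬝ᵥ (X *ᵥ Pi.single j 1) = X i j := by simp
  rw [h4, Complex.normSq_eq_norm_sq] at h2
  have h5 : ‖X i j‖ ^ 2 ≤ 1 := by linarith
  exact (sq_le_one_iff₀ (norm_nonneg _)).mp h5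

lemma continuous_sesq {n : Type*} [Fintype n] (x y : n → ℂ) :
    Continuous fun M : Matrix n n ℂ => sesq M x y := by
  unfold sesq
  fun_prop

lemma isClosed_posSemidef {n : Type*} [Fintype n] :
    IsClosed {M : Matrix n n ℂ | M.PosSemidef} := by
  have : {M : Matrix n n ℂ | M.PosSemidef} =
      {M | Mᴴ = M} ∩ ⋂ x : n → ℂ, {M | 0 ≤ (sesq M x x).re} := by
    ext M
    simp only [Set.mem_ofPred_eq, Set.mem_inter_iff, Set.mem_iInter]
    exact ⟨fun h => ⟨h.1, sesq_self_re_nonneg h⟩, fun h => posSemidef_of_sesq h.1 h.2⟩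
  rw [this]
  refine (isClosed_eq (by fun_prop) continuous_id).inter (isClosed_iInter fun x => ?_)
  exact isClosed_le continuous_const (Complex.continuous_re.comp (continuous_sesq x x))

lemma continuous_pt {m n : Type*} : Continuous (pt : Matrix (m × n) (m × n) ℂ → _) :=
  continuous_pi fun _ => continuous_pi fun _ => continuous_apply_apply _ _

lemma isCompact_isFeasible : IsCompact {X : Op | IsFeasible X} := by
  have hc : IsCompact {X : Op | ∀ i j, X i j ∈ Metric.closedBall (0 : ℂ) 1} := by
    have : IsCompact (Set.univ.pi fun _ : Fin 2 × Fin 2 => Set.univ.pi fun _ : Fin 2 × Fin 2 =>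
        Metric.closedBall (0 : ℂ) 1) :=
      isCompact_univ_pi fun _ => isCompact_univ_pi fun _ => isCompact_closedBall _ _
    change IsCompact {X : Fin 2 × Fin 2 → Fin 2 × Fin 2 → ℂ | ∀ i j, X i j ∈
      Metric.closedBall (0 : ℂ) 1}
    convert this using 1
    ext X
    simp [Set.mem_pi]
  refine hc.of_isClosed_subset ?_ fun X hX i j => ?_
  · have : {X : Op | IsFeasible X} = {X | X.PosSemidef} ∩
        (fun X => (1 / 2 : ℂ) • (1 : Op) - pt X) ⁻¹' {Y | Y.PosSemidef} := by
      ext X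
      exact isFeasible_iff
    rw [this]
    exact isClosed_posSemidef.inter (isClosed_posSemidef.preimage (continuous_const.sub continuous_pt))
  · rw [mem_closedBall_zero_iff]
    exact norm_apply_le_one_of_isFeasible hX i j

lemma exists_isOptimal (ρ : Op) : ∃ X, IsOptimal ρ X := by
  have h0 : IsFeasible (0 : Op) := by
    rw [isFeasible_iff]
    refine ⟨PosSemidef.zero, ?_⟩
    rw [pt_zero, sub_zero]
    have := posSemidef_real_smul (PosSemidef.one (n := Fin 2 × Fin 2) (R := ℂ))
      (t := 1 / 2) (by norm_num)
    simpa using this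
  have hcont : Continuous (objective ρ) := by
    unfold objective
    refine continuous_const.sub (Complex.continuous_re.comp ?_)
    fun_prop
  obtain ⟨X, hX, hmax⟩ := isCompact_isFeasible.exists_isMaxOn ⟨0, h0⟩ hcont.continuousOn
  exact ⟨X, hX, fun Y hY => hmax hY⟩

end Program

/-! ### Optimizers of entangled states: perturbation of the filter. -/

section RankOne

lemma normSq_dotProduct_le (u v : Fin 2 → ℂ) :
    Complex.normSq (u ⬝ᵥ v) ≤ nsq u * nsq v := by
  have h := Complex.normSq_nonneg (u 0 * star (v 1) - u 1 * star (v 0))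
  simp [dotProduct, nsq, Complex.normSq_apply] at h ⊢
  nlinarith

/-- A vector space, here the kernel of Q, is not the union of two proper subspaces. -/
lemma vanish_left_or_right {n : Type*} [Fintype n] {Q : Matrix n n ℂ} {x y : n → ℂ}
    (h : ∀ g, Q *ᵥ g = 0 → (star g ⬝ᵥ x) * (star g ⬝ᵥ y) = 0) :
    (∀ g, Q *ᵥ g = 0 → star g ⬝ᵥ x = 0) ∨ (∀ g, Q *ᵥ g = 0 → star g ⬝ᵥ y = 0) := by
  by_contra! hc
  obtain ⟨⟨g₁, h1, h1x⟩, g₂, h2, h2y⟩ := hc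
  have h1y := (mul_eq_zero.mp (h g₁ h1)).resolve_left h1x
  have h2x := (mul_eq_zero.mp (h g₂ h2)).resolve_right h2y
  have := h (g₁ + g₂) (by rw [mulVec_add, h1, h2, add_zero])
  rw [star_add, add_dotProduct, add_dotProduct, h1y, h2x, add_zero, zero_add] at this
  exact (mul_ne_zero h1x h2y) this

lemma two_mul_re_sesq_le {n : Type*} [Fintype n] {Q : Matrix n n ℂ} (hQ : Q.PosSemidef)
    (x y : n → ℂ) (μ : ℂ) :
    2 * (μ * sesq Q x y).re ≤ (sesq Q x x).re + Complex.normSq μ * (sesq Q y y).re := by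
  have h := sesq_self_re_nonneg hQ (x + (-μ) • y)
  simp only [sesq_add_left, sesq_add_right, sesq_smul_left, sesq_smul_right,
    ← star_sesq hQ.1 x y] at h
  rw [sesq_self_eq_re hQ.1 y] at h
  simp [Complex.normSq_apply] at h ⊢
  nlinarith

lemma nsq_add {n : Type*} [Fintype n] (u v : n → ℂ) :
    nsq (u + v) = nsq u + nsq v + 2 * (star u ⬝ᵥ v).re := by
  simp only [nsq, Pi.add_apply, dotProduct, Complex.re_sum, Finset.mul_sum, ← Finset.sum_add_distrib]
  refine Finset.sum_congr rfl fun i _ => ?_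
  simp [Complex.normSq_apply]
  ring

/-- If the rank-one perturbation `e fᵀ` of the contraction `A` vanishes to first order on the
vectors whose norm `A` preserves, it changes the norm only in second order. -/
lemma exists_nsq_perturbation_le {A : Matrix (Fin 2) (Fin 2) ℂ} (hA : (1 - Aᴴ * A).PosSemidef)
    {e f : Fin 2 → ℂ}
    (h : ∀ g, (1 - Aᴴ * A) *ᵥ g = 0 → (star (A *ᵥ g) ⬝ᵥ e) * (f ⬝ᵥ g) = 0) :
    ∃ C : ℝ, 0 ≤ C ∧ ∀ (s : ℂ) (x : Fin 2 → ℂ),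
      nsq ((A + s • vecMulVec e f) *ᵥ x) ≤ (1 + C * Complex.normSq s) * nsq x := by
  set Q := 1 - Aᴴ * A with hQ
  have hAe : ∀ g, star (A *ᵥ g) ⬝ᵥ e = star g ⬝ᵥ (Aᴴ *ᵥ e) := fun g => by
    rw [star_mulVec, ← dotProduct_mulVec]
  have hf : ∀ g, star g ⬝ᵥ star f = star (f ⬝ᵥ g) := fun g => by
    rw [star_dotProduct_star, dotProduct_comm]
  have hQx : ∀ x, (sesq Q x x).re = nsq x - nsq (A *ᵥ x) := fun f => by
    rw [hQ, sesq_sub_mat, Complex.sub_re, sesq_one_re, sesq, ← mulVec_mulVec, dotProduct_mulVec,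
      ← star_mulVec, star_dotProduct_self, Complex.ofReal_re]
  have hB : ∀ (s : ℂ) (x : Fin 2 → ℂ), nsq ((A + s • vecMulVec e f) *ᵥ x) =
      nsq (A *ᵥ x) + Complex.normSq s * Complex.normSq (f ⬝ᵥ x) * nsq e +
        2 * (s * (f ⬝ᵥ x) * (star x ⬝ᵥ (Aᴴ *ᵥ e))).re := fun s x => by
    have : (A + s • vecMulVec e f) *ᵥ x = A *ᵥ x + (s * (f ⬝ᵥ x)) • e := by
      rw [add_mulVec, smul_mulVec, vecMulVec_mulVec]
      ext i
      simp
      ring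
    rw [this, nsq_add, nsq_smul, Complex.normSq_mul, dotProduct_smul, hAe, smul_eq_mul]
  have hcs : ∀ x, Complex.normSq (f ⬝ᵥ x) ≤ nsq f * nsq x := normSq_dotProduct_le f
  have hcs' : ∀ x, Complex.normSq (star x ⬝ᵥ (Aᴴ *ᵥ e)) ≤ nsq x * nsq (Aᴴ *ᵥ e) := fun x => by
    rw [← nsq_star x]; exact normSq_dotProduct_le _ _
  -- Either A†e or f̄ lies in the range of Q = 1 - A†A. The first-order term is then a Q-form in x,
  -- which the slack ⟨x|Q|x⟩ = |x|² - |Ax|² absorbs up to second order.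
  rcases vanish_left_or_right (Q := Q) (x := Aᴴ *ᵥ e) (y := star f) (fun g hg => by
    rw [← hAe, hf]
    rcases mul_eq_zero.mp (h g hg) with h0 | h0
    · rw [h0, zero_mul]
    · rw [h0, star_zero, mul_zero]) with hv | hv
  · obtain ⟨y, hy⟩ := exists_mulVec_eq hA.1 hv
    have hyy := sesq_self_re_nonneg hA y
    refine ⟨nsq f * ((sesq Q y y).re + nsq e),
      mul_nonneg (nsq_nonneg _) (add_nonneg hyy (nsq_nonneg _)), fun s x => ?_⟩
    have h1 := two_mul_re_sesq_le hA x y (s * (f ⬝ᵥ x))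
    rw [sesq, hy, hQx, Complex.normSq_mul] at h1
    rw [hB]
    have h2 := mul_le_mul_of_nonneg_left (hcs x) (mul_nonneg (Complex.normSq_nonneg s)
      (add_nonneg hyy (nsq_nonneg e)))
    nlinarith
  · obtain ⟨y, hy⟩ := exists_mulVec_eq hA.1 hv
    have hyy := sesq_self_re_nonneg hA y
    refine ⟨nsq (Aᴴ *ᵥ e) * (sesq Q y y).re + nsq f * nsq e,
      add_nonneg (mul_nonneg (nsq_nonneg _) hyy) (mul_nonneg (nsq_nonneg _) (nsq_nonneg _)),
      fun s x => ?_⟩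
    have h1 := two_mul_re_sesq_le hA x y (star (s * (star x ⬝ᵥ (Aᴴ *ᵥ e))))
    have h3 : (star (s * (star x ⬝ᵥ (Aᴴ *ᵥ e))) * sesq Q x y).re =
        (s * (f ⬝ᵥ x) * (star x ⬝ᵥ (Aᴴ *ᵥ e))).re := by
      rw [sesq, hy, hf, ← star_mul', Complex.star_def, Complex.conj_re]
      congr 1
      ring
    rw [h3, hQx, Complex.star_def, Complex.normSq_conj, Complex.normSq_mul] at h1
    rw [hB]
    have h2 := mul_le_mul_of_nonneg_left (hcs x) (mul_nonneg (Complex.normSq_nonneg s)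
      (nsq_nonneg e))
    have h4 := mul_le_mul_of_nonneg_left (hcs' x) (mul_nonneg (Complex.normSq_nonneg s) hyy)
    nlinarith

lemma vecOf_add_smul (A : Matrix (Fin 2) (Fin 2) ℂ) (s : ℂ) (e f : Fin 2 → ℂ) :
    vecOf (A + s • vecMulVec e f) =
      vecOf A + (((1 / √2 : ℝ) : ℂ) * s) • prodVec e f := by
  ext x
  simp [vecOf, prodVec, vecMulVec_apply]
  ring

lemma vecOf_smul (c : ℂ) (A : Matrix (Fin 2) (Fin 2) ℂ) : vecOf (c • A) = c • vecOf A := by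
  ext x
  simp [vecOf]
  ring

lemma sesq_smul_smul_re {n : Type*} [Fintype n] (M : Matrix n n ℂ) (c : ℝ) (x : n → ℂ) :
    (sesq M ((c : ℂ) • x) ((c : ℂ) • x)).re = c ^ 2 * (sesq M x x).re := by
  rw [sesq_smul_left, sesq_smul_right, Complex.star_def, Complex.conj_ofReal, ← mul_assoc,
    ← Complex.ofReal_mul, Complex.re_ofReal_mul, sq]

/-- The expectation value of `ρ^Γ` in any filter direction is bounded by the optimal one. -/
lemma optimal_sesq_le {ρ : Op} {A B : Matrix (Fin 2) (Fin 2) ℂ}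
    (hA : IsOptimal ρ (rankOneOp A)) {c : ℝ} (hc : 0 < c) (hB : ∀ x, nsq (B *ᵥ x) ≤ c * nsq x) :
    c * (sesq (pt ρ) (vecOf A) (vecOf A)).re ≤ (sesq (pt ρ) (vecOf B) (vecOf B)).re := by
  have hs : √(c⁻¹) ^ 2 = c⁻¹ := Real.sq_sqrt (inv_nonneg.mpr hc.le)
  -- B/√c is a contraction and thus competes with A in the program.
  have hF : IsFeasible (rankOneOp (((√(c⁻¹) : ℝ) : ℂ) • B)) := by
    rw [isFeasible_rankOneOp_iff, one_sub_conjTranspose_mul_self_posSemidef_iff]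
    intro x
    rw [smul_mulVec, nsq_smul, Complex.normSq_ofReal, ← sq, hs, inv_mul_le_iff₀ hc]
    exact hB x
  have h := hA.2 _ hF
  rw [rankOneOp_eq_proj, rankOneOp_eq_proj, objective_proj, objective_proj, vecOf_smul,
    sesq_smul_smul_re, hs] at h
  have h2 : (sesq (pt ρ) (vecOf A) (vecOf A)).re ≤
    c⁻¹ * (sesq (pt ρ) (vecOf B) (vecOf B)).re := by linarith
  rwa [le_inv_mul_iff₀ hc] at h2

/-- A linear term dominated by a quadratic one vanishes; s = z̄/(K + 1) is small enough to show it.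
-/
lemma eq_zero_of_quadratic_bound {z : ℂ} {K : ℝ} (hK : 0 ≤ K)
    (h : ∀ s : ℂ, 2 * (s * z).re ≤ K * Complex.normSq s) : z = 0 := by
  have h1 := h (((1 / (K + 1) : ℝ) : ℂ) * star z)
  rw [mul_assoc, Complex.re_ofReal_mul, Complex.normSq_mul, Complex.normSq_ofReal, Complex.star_def,
    Complex.normSq_conj, ← Complex.normSq_eq_conj_mul_self, Complex.ofReal_re] at h1
  have h2 := Complex.normSq_nonneg z
  have hK' : 0 < K + 1 := by linarith
  have h3 : 2 * Complex.normSq z * (K + 1) ≤ K * Complex.normSq z := by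
    have := mul_le_mul_of_nonneg_right h1 (mul_pos hK' hK').le
    field_simp at this
    nlinarith
  exact Complex.normSq_eq_zero.mp (by nlinarith)

/-- A vector orthogonal to `e`. -/
def perp (e : Fin 2 → ℂ) : Fin 2 → ℂ := ![-star (e 1), star (e 0)]

lemma exists_frame_combination {e : Fin 2 → ℂ} (he : e ≠ 0) (x : Fin 2 → ℂ) :
    ∃ a b : ℂ, x = a • e + b • perp e := by
  have h : frame e *ᵥ ((frame e)⁻¹ *ᵥ x) = x := by
    rw [mulVec_mulVec, Matrix.mul_nonsing_inv _ (isUnit_det_frame he), one_mulVec]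
  refine ⟨((frame e)⁻¹ *ᵥ x) 0, ((frame e)⁻¹ *ᵥ x) 1, ?_⟩
  conv_lhs => rw [← h]
  generalize (frame e)⁻¹ *ᵥ x = y
  ext i
  fin_cases i <;> simp [frame, perp, mulVec, dotProduct] <;> ring

lemma exists_prodVec_combination {e f : Fin 2 → ℂ} (he : e ≠ 0) (hf : f ≠ 0)
    (v : Fin 2 × Fin 2 → ℂ) : ∃ a b c d : ℂ, v = a • prodVec e f + b • prodVec e (perp f) +
      c • prodVec (perp e) f + d • prodVec (perp e) (perp f) := by
  obtain ⟨p, q, hpq⟩ := exists_frame_combination hf fun j => v (0, j)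
  obtain ⟨r, s, hrs⟩ := exists_frame_combination hf fun j => v (1, j)
  obtain ⟨k, l, hkl⟩ := exists_frame_combination he ![1, 0]
  obtain ⟨m, n, hmn⟩ := exists_frame_combination he ![0, 1]
  refine ⟨k * p + m * r, k * q + m * s, l * p + n * r, l * q + n * s, ?_⟩
  ext ⟨i, j⟩
  have h0 := congrFun hpq j
  have h1 := congrFun hrs j
  have h2 := congrFun hkl i
  have h3 := congrFun hmn i
  have h4 : v (i, j) = ![1, 0] i * v (0, j) + ![0, 1] i * v (1, j) := by
    fin_cases i <;> simp
  rw [h4, h0, h1, h2, h3]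
  simp [prodVec]
  ring

/-- An optimal filter for an entangled state leaves no room for a product vector. -/
lemma false_of_optimal_add_proj {ρ : Op} (hρ : ρ.PosSemidef) (hsep : ρ ∉ sepCone)
    {A : Matrix (Fin 2) (Fin 2) ℂ} (hA : IsOptimal ρ (rankOneOp A))
    (hneg : (sesq (pt ρ) (vecOf A) (vecOf A)).re < 0) {e f : Fin 2 → ℂ} (h0 : prodVec e f ≠ 0)
    (hker : ρ *ᵥ prodVec e (star f) = 0) {t : ℝ} (ht : 0 < t)
    (hF : IsFeasible (rankOneOp A + (t : ℂ) • proj (prodVec e f))) : False := by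
  have he := left_ne_zero_of_prodVec h0
  have hf := right_ne_zero_of_prodVec h0
  have hAc := isFeasible_rankOneOp_iff.mp hA.1
  have hW : (pt ρ).IsHermitian := pt_isHermitian hρ.1
  have hker' : ∀ x, sesq ρ x (prodVec e (star f)) = 0 := fun x => by
    rw [sesq, hker, dotProduct_zero]
  have hker'' : ∀ x, sesq ρ (prodVec e (star f)) x = 0 := fun x => by
    rw [← star_sesq hρ.1, hker', star_zero]
  -- At (Ag) ⊗ ḡ with |Ag| = |g|, the operator `rankOneOp A` alone already reaches the bound |g|⁴/2,
  -- so the added projector must vanish there.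
  have hfirst : ∀ g, (1 - Aᴴ * A) *ᵥ g = 0 → (star (A *ᵥ g) ⬝ᵥ e) * (f ⬝ᵥ g) = 0 := by
    intro g hg
    have hn : nsq (A *ᵥ g) = nsq g := by
      have h1 : (sesq (1 - Aᴴ * A) g g).re = nsq g - nsq (A *ᵥ g) := by
        rw [sesq_sub_mat, Complex.sub_re, sesq_one_re, sesq, ← mulVec_mulVec, dotProduct_mulVec,
          ← star_mulVec, star_dotProduct_self, Complex.ofReal_re]
      rw [sesq, hg, dotProduct_zero, Complex.zero_re] at h1
      linarith
    have h1 := sesq_prodVec_le hF.1.1 (isFeasible_iff.mp hF).2 (A *ᵥ g) (star g)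
    rw [rankOneOp_eq_proj, sesq_add_mat, sesq_smul_mat, Complex.add_re, Complex.re_ofReal_mul,
      sesq_proj_self_re, sesq_proj_self_re, star_prodVec_dotProduct_vecOf, star_star,
      star_dotProduct_self, ← Complex.ofReal_mul, Complex.normSq_ofReal, nsq_star, hn] at h1
    have h2 : 1 / √2 * nsq g * (1 / √2 * nsq g) = nsq g * nsq g / 2 := by
      have := inv_sqrt_two_sq
      linear_combination nsq g * nsq g * this
    rw [h2] at h1
    have h3 : star (prodVec (A *ᵥ g) (star g)) ⬝ᵥ prodVec e f =
        (star (A *ᵥ g) ⬝ᵥ e) * (f ⬝ᵥ g) := by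
      simp [dotProduct, prodVec, Fintype.sum_prod_type]
      ring
    rw [h3] at h1
    refine Complex.normSq_eq_zero.mp (le_antisymm ?_ (Complex.normSq_nonneg _))
    refine le_of_mul_le_mul_left ?_ ht
    linarith
  obtain ⟨C, hC, hCb⟩ := exists_nsq_perturbation_le hAc hfirst
  have hpp : sesq (pt ρ) (prodVec e f) (prodVec e f) = 0 := by rw [sesq_pt_prodVec, hker']
  -- Moving A along e fᵀ changes its norm only in second order, so optimality kills the first-order
  -- change of the objective. The factor √2 cancels the normalization in `vecOf`.
  have hcross : sesq (pt ρ) (vecOf A) (prodVec e f) = 0 := by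
    refine eq_zero_of_quadratic_bound
      (K := 2 * C * -(sesq (pt ρ) (vecOf A) (vecOf A)).re)
      (mul_nonneg (by linarith) (by linarith)) fun s => ?_
    have h2 : (0 : ℝ) < √2 := by positivity
    have hc : ((1 / √2 : ℝ) : ℂ) * (((√2 : ℝ) : ℂ) * -s) = -s := by
      rw [← mul_assoc, ← Complex.ofReal_mul, one_div_mul_cancel h2.ne', Complex.ofReal_one, one_mul]
    have h1 := optimal_sesq_le hA (B := A + (((√2 : ℝ) : ℂ) * -s) • vecMulVec e f)
      (c := 1 + C * Complex.normSq (((√2 : ℝ) : ℂ) * -s))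
      (by have := mul_nonneg hC (Complex.normSq_nonneg (((√2 : ℝ) : ℂ) * -s)); linarith) (hCb _)
    rw [vecOf_add_smul, hc, Complex.normSq_mul, Complex.normSq_ofReal, Complex.normSq_neg,
      Real.mul_self_sqrt (by norm_num)] at h1
    simp only [sesq_add_left, sesq_add_right, sesq_smul_left, sesq_smul_right, hpp,
      ← star_sesq hW (vecOf A) (prodVec e f)] at h1
    simp at h1 ⊢
    nlinarith
  obtain ⟨a, b, c, d, habcd⟩ := exists_prodVec_combination he hf (vecOf A)
  -- As ρ annihilates e ⊗ f̄, only the e⊥ ⊗ f⊥ component of the filter contributes to the cross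
  -- term.
  have hd : d = 0 ∨ sesq (pt ρ) (prodVec (perp e) (perp f)) (prodVec e f) = 0 := by
    rw [habcd] at hcross
    simp only [sesq_add_left, sesq_smul_left] at hcross
    rw [sesq_pt_prodVec ρ e f, sesq_pt_prodVec ρ e (perp f), sesq_pt_prodVec ρ (perp e) f,
      hker', hker'', hker'] at hcross
    simpa using hcross
  rcases hd with rfl | hw
  -- Without that component, only the diagonal terms of b and c remain. They are expectations of ρ,
  -- so the form cannot be negative.
  · rw [habcd] at hneg
    simp only [zero_smul, add_zero, sesq_add_left, sesq_add_right, sesq_smul_left,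
      sesq_smul_right] at hneg
    have h3 : sesq (pt ρ) (prodVec (perp e) f) (prodVec e (perp f)) =
        star (sesq (pt ρ) (prodVec e (perp f)) (prodVec (perp e) f)) :=
      (star_sesq hW _ _).symm
    rw [h3] at hneg
    simp only [sesq_pt_prodVec, hker', hker''] at hneg
    have h1 := sesq_self_re_nonneg hρ (prodVec e (star (perp f)))
    have h2 := sesq_self_re_nonneg hρ (prodVec (perp e) (star f))
    rw [sesq_self_eq_re hρ.1 (prodVec e (star (perp f))),
      sesq_self_eq_re hρ.1 (prodVec (perp e) (star f))] at hneg
    simp at hneg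
    nlinarith [mul_nonneg (Complex.normSq_nonneg b) h1, mul_nonneg (Complex.normSq_nonneg c) h2,
      Complex.normSq_apply b, Complex.normSq_apply c]
  -- Here ρ^Γ(e ⊗ f) is orthogonal to a whole product basis. So ρ^Γ annihilates e ⊗ f while ρ
  -- annihilates e ⊗ f̄, which forces separability.
  · have hWp : pt ρ *ᵥ prodVec e f = 0 := by
      rw [← dotProduct_star_self_eq_zero]
      obtain ⟨a', b', c', d', h'⟩ := exists_prodVec_combination he hf (pt ρ *ᵥ prodVec e f)
      have : sesq (pt ρ) (pt ρ *ᵥ prodVec e f) (prodVec e f) = 0 := by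
        conv_lhs => rw [h']
        simp only [sesq_add_left, sesq_smul_left, hw]
        rw [sesq_pt_prodVec ρ e f, sesq_pt_prodVec ρ e (perp f), sesq_pt_prodVec ρ (perp e) f,
          hker', hker'', hker']
        simp
      exact this
    exact hsep (mem_sepCone_of_ker_prodVec hρ he (star_ne_zero.mpr hf) hker
      (by rwa [star_star]))

end RankOne

/-! ### LOCC bound, and the filter protocol that attains it. -/

section LOCC

/-- The constraints of the semidefinite program for local systems of any size. -/
def IsGenFeasible {m n : Type*} [Fintype m] [Fintype n] [DecidableEq m] [DecidableEq n]
    (Y : Matrix (m × n) (m × n) ℂ) : Prop :=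
  Y.PosSemidef ∧ (1 - Y).PosSemidef ∧ (pt Y + (1 / 2 : ℂ) • 1).PosSemidef ∧
    ((1 / 2 : ℂ) • 1 - pt Y).PosSemidef

/-- Each constraint compares Y or Y^Γ with a multiple of the identity, and the two completeness
relations reproduce that identity on either side of the transpose. -/
lemma isGenFeasible_sum {m n : Type*} [Fintype m] [Fintype n] [DecidableEq m] [DecidableEq n]
    {K : ℕ} {m' n' : Fin K → Type*} [∀ k, Fintype (m' k)] [∀ k, Fintype (n' k)]
    [∀ k, DecidableEq (m' k)] [∀ k, DecidableEq (n' k)]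
    (A : ∀ k, Matrix m (m' k) ℂ) (B : ∀ k, Matrix n (n' k) ℂ)
    (h1 : ∑ k, (A k ⊗ₖ B k) * (A k ⊗ₖ B k)ᴴ = 1)
    (h2 : ∑ k, (A k ⊗ₖ (B k).map star) * (A k ⊗ₖ (B k).map star)ᴴ = 1)
    {Y : ∀ k, Matrix (m' k × n' k) (m' k × n' k) ℂ} (hY : ∀ k, IsGenFeasible (Y k)) :
    IsGenFeasible (∑ k, (A k ⊗ₖ B k) * Y k * (A k ⊗ₖ B k)ᴴ) := by
  have hpt : pt (∑ k, (A k ⊗ₖ B k) * Y k * (A k ⊗ₖ B k)ᴴ) =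
      ∑ k, (A k ⊗ₖ (B k).map star) * pt (Y k) * (A k ⊗ₖ (B k).map star)ᴴ := by
    rw [pt_sum]
    exact Finset.sum_congr rfl fun k _ => pt_conj _ _ _
  refine ⟨posSemidef_sum _ fun k _ => (hY k).1.mul_mul_conjTranspose_same _, ?_, ?_, ?_⟩
  · rw [← h1, ← Finset.sum_sub_distrib]
    refine posSemidef_sum _ fun k _ => ?_
    have := (hY k).2.1.mul_mul_conjTranspose_same (A k ⊗ₖ B k)
    rwa [Matrix.mul_sub, Matrix.sub_mul, Matrix.mul_one] at this
  · rw [hpt, ← h2, Finset.smul_sum, ← Finset.sum_add_distrib]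
    refine posSemidef_sum _ fun k _ => ?_
    have := (hY k).2.2.1.mul_mul_conjTranspose_same (A k ⊗ₖ (B k).map star)
    rwa [Matrix.mul_add, Matrix.add_mul, Matrix.mul_smul, Matrix.smul_mul, Matrix.mul_one] at this
  · rw [hpt, ← h2, Finset.smul_sum, ← Finset.sum_sub_distrib]
    refine posSemidef_sum _ fun k _ => ?_
    have := (hY k).2.2.2.mul_mul_conjTranspose_same (A k ⊗ₖ (B k).map star)
    rwa [Matrix.mul_sub, Matrix.sub_mul, Matrix.mul_smul, Matrix.smul_mul, Matrix.mul_one] at this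

lemma conjTranspose_one_kronecker {m n n' : Type*} [DecidableEq m] (B : Matrix n n' ℂ) :
    ((1 : Matrix m m ℂ) ⊗ₖ B)ᴴ = (1 : Matrix m m ℂ) ⊗ₖ Bᴴ := by
  rw [conjTranspose_kronecker, conjTranspose_one]

lemma conjTranspose_kronecker_one {m n n' : Type*} [DecidableEq m] (B : Matrix n n' ℂ) :
    (B ⊗ₖ (1 : Matrix m m ℂ))ᴴ = Bᴴ ⊗ₖ (1 : Matrix m m ℂ) := by
  rw [conjTranspose_kronecker, conjTranspose_one]

lemma map_star_one {n : Type*} [DecidableEq n] : (1 : Matrix n n ℂ).map star = 1 :=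
  Matrix.map_one star (star_zero ℂ) (star_one ℂ)

lemma kronecker_one_sum {m n ι : Type*} [DecidableEq n] (s : Finset ι)
    (M : ι → Matrix m m ℂ) :
    (∑ k ∈ s, M k) ⊗ₖ (1 : Matrix n n ℂ) = ∑ k ∈ s, M k ⊗ₖ (1 : Matrix n n ℂ) := by
  ext i j
  simp [Matrix.sum_apply, Finset.sum_mul]

lemma one_kronecker_sum {m n ι : Type*} [DecidableEq n] (s : Finset ι)
    (M : ι → Matrix m m ℂ) :
    (1 : Matrix n n ℂ) ⊗ₖ (∑ k ∈ s, M k) = ∑ k ∈ s, (1 : Matrix n n ℂ) ⊗ₖ M k := by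
  ext i j
  simp [Matrix.sum_apply, Finset.mul_sum]

lemma trace_mul_conj {m n : Type*} [Fintype m] [Fintype n] (Y : Matrix m m ℂ) (V : Matrix m n ℂ)
    (σ : Matrix n n ℂ) : (Y * (V * σ * Vᴴ)).trace = (Vᴴ * Y * V * σ).trace := by
  rw [← Matrix.mul_assoc, trace_mul_comm, ← Matrix.mul_assoc, ← Matrix.mul_assoc]

/-- In the Heisenberg picture, an LOCC protocol preserves the constraints of the program. -/
lemma exists_isGenFeasible_adjoint {d e : ℕ}
    {Φ : Matrix (Fin d × Fin e) (Fin d × Fin e) ℂ → Op} (hΦ : IsFiniteLOCC d e Φ) {Z : Op}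
    (hZ : IsFeasible Z) : ∃ Y : Matrix (Fin d × Fin e) (Fin d × Fin e) ℂ,
      IsGenFeasible Y ∧ ∀ σ, (Z * Φ σ).trace = (Y * σ).trace := by
  induction hΦ with
  | done => exact ⟨Z, hZ, fun σ => rfl⟩
  | @alice d e K d' A hA Φ _ ih =>
    choose Y hY hYΦ using ih
    refine ⟨∑ k, ((A k)ᴴ ⊗ₖ (1 : Matrix (Fin e) (Fin e) ℂ)) * Y k *
      ((A k)ᴴ ⊗ₖ (1 : Matrix (Fin e) (Fin e) ℂ))ᴴ, ?_, fun σ => ?_⟩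
    · have h : ∑ k, ((A k)ᴴ ⊗ₖ (1 : Matrix (Fin e) (Fin e) ℂ)) *
          ((A k)ᴴ ⊗ₖ (1 : Matrix (Fin e) (Fin e) ℂ))ᴴ = 1 := by
        simp only [conjTranspose_kronecker_one, conjTranspose_conjTranspose, ← mul_kronecker_mul,
          one_mul]
        rw [← kronecker_one_sum, hA, one_kronecker_one]
      exact isGenFeasible_sum (fun k => (A k)ᴴ) (fun _ => 1) h (by simpa only [map_star_one] using h) hY
    · rw [Finset.mul_sum, Finset.sum_mul, trace_sum, trace_sum]
      refine Finset.sum_congr rfl fun k _ => ?_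
      rw [hYΦ, trace_mul_conj, conjTranspose_kronecker_one, conjTranspose_kronecker_one,
        conjTranspose_conjTranspose]
  | @bob d e K e' B hB Φ _ ih =>
    choose Y hY hYΦ using ih
    refine ⟨∑ k, ((1 : Matrix (Fin d) (Fin d) ℂ) ⊗ₖ (B k)ᴴ) * Y k *
      ((1 : Matrix (Fin d) (Fin d) ℂ) ⊗ₖ (B k)ᴴ)ᴴ, ?_, fun σ => ?_⟩
    · refine isGenFeasible_sum (fun _ => 1) (fun k => (B k)ᴴ) ?_ ?_ hY
      · simp only [conjTranspose_one_kronecker, conjTranspose_conjTranspose, ← mul_kronecker_mul,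
          one_mul]
        rw [← one_kronecker_sum, hB, one_kronecker_one]
      -- Completeness of the conjugated operators is the entrywise conjugate of Bob's completeness
      -- relation.
      · have h : ∀ k, ((B k)ᴴ.map star) * ((B k)ᴴ.map star)ᴴ = ((B k)ᴴ * B k)ᵀᴴ := fun k => by
          ext i j
          simp [Matrix.mul_apply, mul_comm]
        simp only [conjTranspose_one_kronecker, ← mul_kronecker_mul, one_mul, h]
        rw [← one_kronecker_sum, ← conjTranspose_sum, ← transpose_sum, hB, transpose_one,
          conjTranspose_one, one_kronecker_one]
    · rw [Finset.mul_sum, Finset.sum_mul, trace_sum, trace_sum]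
      refine Finset.sum_congr rfl fun k _ => ?_
      rw [hYΦ, trace_mul_conj, conjTranspose_one_kronecker, conjTranspose_one_kronecker,
        conjTranspose_conjTranspose]

/-- Maximally entangled vectors are `vecOf A` with A unitary, in particular a contraction. -/
lemma isFeasible_proj_of_isMaxEntangled {v : Fin 2 × Fin 2 → ℂ} (hv : IsMaxEntangled v) :
    IsFeasible (proj v) := by
  obtain ⟨A, rfl⟩ := exists_eq_vecOf v
  have hA : A * Aᴴ = 1 := by
    have h1 : (Matrix.of fun a b => vecOf A (a, b)) = ((1 / √2 : ℝ) : ℂ) • A := by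
      ext a b
      simp [vecOf]
    rw [IsMaxEntangled, h1, conjTranspose_smul, smul_mul_smul_comm, Complex.star_def,
      Complex.conj_ofReal, ← Complex.ofReal_mul, inv_sqrt_two_sq] at hv
    have h2 : ((1 / 2 : ℝ) : ℂ) = 1 / 2 := by norm_num
    rw [h2] at hv
    exact smul_right_injective _ (by norm_num : (1 / 2 : ℂ) ≠ 0) hv
  rw [← rankOneOp_eq_proj, isFeasible_rankOneOp_iff, mul_eq_one_comm.mp hA, sub_self]
  exact PosSemidef.zero

lemma objective_half_sub_pt {ρ : Op} (hρ : ρ.trace = 1) (Y : Op) :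
    objective ρ ((1 / 2 : ℂ) • (1 : Op) - pt Y) = (Y * ρ).trace.re := by
  rw [objective_eq, sub_mul, smul_mul_assoc, one_mul, trace_sub, trace_smul, trace_pt, hρ,
    trace_pt_mul, pt_pt]
  simp

lemma expect_eq (ρ : Op) (v : Fin 2 × Fin 2 → ℂ) : expect ρ v = (proj v * ρ).trace.re := by
  rw [trace_mul_comm, trace_mul_proj]
  rfl

lemma expect_le_of_isFiniteLOCC {ρ : Op} (hρ : ρ.trace = 1) {F : ℝ}
    (hF : ∀ X, IsFeasible X → objective ρ X ≤ F) {Φ : Op → Op} (hΦ : IsFiniteLOCC 2 2 Φ)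
    {v : Fin 2 × Fin 2 → ℂ} (hv : IsMaxEntangled v) : expect (Φ ρ) v ≤ F := by
  obtain ⟨Y, hY, hYΦ⟩ := exists_isGenFeasible_adjoint hΦ (isFeasible_proj_of_isMaxEntangled hv)
  rw [expect_eq, hYΦ, ← objective_half_sub_pt hρ]
  exact hF _ (isFeasible_half_sub_pt hY)

lemma expect_le_of_isLOCC {ρ : Op} (hρ : ρ.trace = 1) {F : ℝ}
    (hF : ∀ X, IsFeasible X → objective ρ X ≤ F) {Λ : Op → Op} (hΛ : IsLOCC Λ)
    {v : Fin 2 × Fin 2 → ℂ} (hv : IsMaxEntangled v) : expect (Λ ρ) v ≤ F := by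
  obtain ⟨Φ, hΦ, hlim⟩ := hΛ
  have hcont : Continuous fun M : Op => expect M v :=
    Complex.continuous_re.comp (continuous_sesq v v)
  exact le_of_tendsto' ((hcont.tendsto _).comp (hlim ρ))
    fun j => expect_le_of_isFiniteLOCC hρ hF (hΦ j) hv

lemma isMaxEntangled_psi : IsMaxEntangled psi := by
  have h1 : (Matrix.of fun a b => psi (a, b)) =
      ((1 / √2 : ℝ) : ℂ) • (1 : Matrix (Fin 2) (Fin 2) ℂ) := by
    ext a b
    simp [psi, Matrix.one_apply]
  rw [IsMaxEntangled, h1, conjTranspose_smul, smul_mul_smul_comm, Complex.star_def,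
    Complex.conj_ofReal, ← Complex.ofReal_mul, inv_sqrt_two_sq, conjTranspose_one, mul_one]
  norm_num

lemma fidelity_le_of_isLOCC {ρ : Op} (hρ : ρ.trace = 1) {F : ℝ}
    (hF : ∀ X, IsFeasible X → objective ρ X ≤ F) {Λ : Op → Op} (hΛ : IsLOCC Λ) :
    fidelity (Λ ρ) ≤ F := by
  refine csSup_le ⟨_, psi, isMaxEntangled_psi, rfl⟩ ?_
  rintro f ⟨v, hv, rfl⟩
  exact expect_le_of_isLOCC hρ hF hΛ hv

/-- A real supremum dominates its members only if the set is bounded; the value of the program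
supplies the bound. -/
lemma expect_psi_le_fidelity {ρ : Op} (hρ : ρ.trace = 1) {F : ℝ}
    (hF : ∀ X, IsFeasible X → objective ρ X ≤ F) {Λ : Op → Op} (hΛ : IsLOCC Λ) :
    expect (Λ ρ) psi ≤ fidelity (Λ ρ) := by
  refine le_csSup ⟨F, ?_⟩ ⟨psi, isMaxEntangled_psi, rfl⟩
  rintro f ⟨v, hv, rfl⟩
  exact expect_le_of_isLOCC hρ hF hΛ hv

lemma IsOneWayLOCC.isLOCC {Λ : Op → Op} (h : IsOneWayLOCC Λ) : IsLOCC Λ := by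
  obtain ⟨K, A, L, B, hA, hB, hΛ⟩ := h
  have key : IsFiniteLOCC 2 2 Λ := by
    have h1 := IsFiniteLOCC.alice (fun _ => 2) A hA _ fun k =>
      IsFiniteLOCC.bob (d := 2) (fun _ => 2) (B k) (hB k) _ fun _ => IsFiniteLOCC.done
    convert h1 using 1
    funext σ
    rw [hΛ]
    refine Finset.sum_congr rfl fun k _ => Finset.sum_congr rfl fun l _ => ?_
    have h2 : A k ⊗ₖ B k l = ((1 : Matrix (Fin 2) (Fin 2) ℂ) ⊗ₖ B k l) *
        (A k ⊗ₖ (1 : Matrix (Fin 2) (Fin 2) ℂ)) := by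
      rw [← mul_kronecker_mul, one_mul, mul_one]
    rw [h2, conjTranspose_mul]
    simp only [Matrix.mul_assoc]
  exact ⟨fun _ => Λ, fun _ => key, fun σ => tendsto_const_nhds⟩

/-- By Cauchy–Schwarz, |A†y|⁴ = ⟨y|AA†y⟩² ≤ |y|²|AA†y|² ≤ |y|²|A†y|². -/
lemma one_sub_mul_conjTranspose_posSemidef {A : Matrix (Fin 2) (Fin 2) ℂ}
    (hA : (1 - Aᴴ * A).PosSemidef) : (1 - A * Aᴴ).PosSemidef := by
  rw [one_sub_conjTranspose_mul_self_posSemidef_iff] at hA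
  have h := (one_sub_conjTranspose_mul_self_posSemidef_iff (A := Aᴴ)).mpr fun y => ?_
  · rwa [conjTranspose_conjTranspose] at h
  have h1 := normSq_dotProduct_le (star y) (A *ᵥ (Aᴴ *ᵥ y))
  have h2 : star y ⬝ᵥ (A *ᵥ (Aᴴ *ᵥ y)) = (nsq (Aᴴ *ᵥ y) : ℂ) := by
    rw [← star_dotProduct_self, star_mulVec, conjTranspose_conjTranspose, ← dotProduct_mulVec]
  rw [h2, Complex.normSq_ofReal, nsq_star] at h1
  have h3 := hA (Aᴴ *ᵥ y)
  have h4 := nsq_nonneg (Aᴴ *ᵥ y)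
  rcases h4.eq_or_lt with h5 | h5
  · rw [← h5]; exact nsq_nonneg y
  · refine le_of_mul_le_mul_left (h1.trans ?_) h5
    rw [mul_comm]
    exact mul_le_mul_of_nonneg_right h3 (nsq_nonneg y)

/-- The Kraus operator `|0⟩⟨r|` for the `i`-th row `⟨r|` of `R`. -/
def resetRow (R : Matrix (Fin 2) (Fin 2) ℂ) (i : Fin 2) : Matrix (Fin 2) (Fin 2) ℂ :=
  Matrix.of fun a c => if a = 0 then R i c else 0

lemma isOneWayLOCC_filterProtocol {M : Matrix (Fin 2) (Fin 2) ℂ}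
    (hM : (1 - Mᴴ * M).PosSemidef) : IsOneWayLOCC (filterProtocol M) := by
  obtain ⟨S, hS⟩ := exists_eq_mul_conjTranspose hM
  obtain ⟨R, rfl⟩ : ∃ R : Matrix (Fin 2) (Fin 2) ℂ, S = Rᴴ :=
    ⟨Sᴴ, (conjTranspose_conjTranspose S).symm⟩
  rw [conjTranspose_conjTranspose] at hS
  have hrow : (resetRow R 0)ᴴ * resetRow R 0 + (resetRow R 1)ᴴ * resetRow R 1 = Rᴴ * R := by
    ext i j
    simp [Matrix.mul_apply, resetRow]
  -- Failure is split into two outcomes by 1 - M†M = R†R; Alice resets with |0⟩⟨r|, Bob with |0⟩⟨0|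
  -- and |0⟩⟨1|. On success Bob's identity is padded with a zero Kraus operator.
  refine ⟨3, ![M, resetRow R 0, resetRow R 1], fun _ => 2,
    ![![1, 0], ![Matrix.single 0 0 1, Matrix.single 0 1 1],
      ![Matrix.single 0 0 1, Matrix.single 0 1 1]], ?_, ?_, fun σ => ?_⟩
  · simp only [Fin.sum_univ_three, cons_val_zero, cons_val_one, cons_val]
    rw [add_assoc, hrow, ← hS, add_sub_cancel]
  · have h : ((Matrix.single 0 0 1 : Matrix (Fin 2) (Fin 2) ℂ))ᴴ * Matrix.single 0 0 1 +
        ((Matrix.single 0 1 1 : Matrix (Fin 2) (Fin 2) ℂ))ᴴ * Matrix.single 0 1 1 = 1 := by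
      ext i j
      fin_cases i <;> fin_cases j <;> simp
    intro k
    fin_cases k
    · simp
    · simpa using h
    · simpa using h
  · rw [filterProtocol, hS]
    simp only [Fin.sum_univ_three, Fin.sum_univ_two, cons_val_zero, cons_val_one, cons_val,
      kronecker_zero, zero_mul, add_zero]
    rw [add_assoc]
    congr 1
    ext ⟨a, b⟩ ⟨c, d⟩
    fin_cases a <;> fin_cases b <;> fin_cases c <;> fin_cases d <;>
      simp [Matrix.mul_apply, Matrix.trace, Fintype.sum_prod_type, proj_apply, ket00, resetRow,
        Matrix.single_apply, Matrix.one_apply]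
    ring

lemma sigmaY_conjTranspose : sigmaYᴴ = sigmaY := by
  ext i j
  fin_cases i <;> fin_cases j <;> simp [sigmaY]

lemma sigmaY_mul_self : sigmaY * sigmaY = 1 := by
  ext i j
  fin_cases i <;> fin_cases j <;> simp [sigmaY, Matrix.mul_apply]

lemma filter_conjTranspose_mul_self (A : Matrix (Fin 2) (Fin 2) ℂ) :
    (sigmaY * Aᴴ)ᴴ * (sigmaY * Aᴴ) = A * Aᴴ := by
  rw [conjTranspose_mul, conjTranspose_conjTranspose, sigmaY_conjTranspose, Matrix.mul_assoc,
    ← Matrix.mul_assoc sigmaY, sigmaY_mul_self, Matrix.one_mul]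

lemma sesq_conj {m n : Type*} [Fintype m] [Fintype n] (M : Matrix m n ℂ) (σ : Matrix n n ℂ)
    (v : m → ℂ) : sesq (M * σ * Mᴴ) v v = sesq σ (Mᴴ *ᵥ v) (Mᴴ *ᵥ v) := by
  rw [sesq, sesq, star_mulVec, conjTranspose_conjTranspose, ← mulVec_mulVec, ← mulVec_mulVec,
    dotProduct_mulVec]

/-- The overlap of the output of the filter protocol with `|ψ⟩` is the value of the program. -/
lemma expect_filterProtocol {ρ : Op} (hρ : ρ.trace = 1) (A : Matrix (Fin 2) (Fin 2) ℂ) :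
    expect (filterProtocol (sigmaY * Aᴴ) ρ) psi = objective ρ (rankOneOp A) := by
  have h0 : sesq (proj ket00) psi psi = 1 / 2 := by
    have : ((1 / √2 : ℝ) : ℂ) * ((1 / √2 : ℝ) : ℂ) = 1 / 2 := by
      rw [← Complex.ofReal_mul, inv_sqrt_two_sq]; norm_num
    rw [sesq_proj, ← this]
    simp [ket00, psi]
  -- The failure branch contributes half its probability. The success branch uses that (AA† ⊗ 1)/2
  -- minus the partial transpose of `rankOneOp A` is the projector on (Aσ_y ⊗ 1)|ψ⟩.
  have h1 : sesq (filterProtocol (sigmaY * Aᴴ) ρ) psi psi =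
      (1 / 2 : ℂ) * ρ.trace - sesq (pt ρ) (vecOf A) (vecOf A) := by
    rw [filterProtocol, sesq_add_mat, sesq_smul_mat, h0, sesq_conj, conjTranspose_kronecker_one,
      kronecker_one_mulVec_psi, filter_conjTranspose_mul_self, conjTranspose_mul,
      conjTranspose_conjTranspose, sigmaY_conjTranspose]
    have h2 : ((1 / √2 : ℝ) : ℂ) * ((1 / √2 : ℝ) : ℂ) = 1 / 2 := by
      rw [← Complex.ofReal_mul, inv_sqrt_two_sq]; norm_num
    have h3 : A * sigmaY = Complex.I • (A * !![0, -1; 1, 0]) := by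
      rw [← mul_smul_comm]
      congr 1
      ext i j
      fin_cases i <;> fin_cases j <;> simp [sigmaY]
    rw [h3, vecOf_smul, sesq_smul_left, sesq_smul_right, ← mul_assoc, Complex.star_def,
      Complex.conj_I, neg_mul, Complex.I_mul_I, neg_neg, one_mul, ← h2]
    simp only [sesq, dotProduct, mulVec, vecOf, pt_apply, Matrix.trace, Matrix.diag,
      Matrix.mul_apply, kronecker_apply, Fintype.sum_prod_type, Fin.sum_univ_two, Pi.star_apply,
      star_mul', star_add, Complex.star_def, Complex.conj_ofReal, Matrix.sub_apply,
      Matrix.one_apply, conjTranspose_apply]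
    simp
    ring
  rw [rankOneOp_eq_proj, objective_proj]
  change (sesq _ psi psi).re = _
  rw [h1, hρ]
  simp

end LOCC

/-! ### Teleportation fidelity as a function of the overlap with ψ. -/

section Teleportation

lemma bell_eq_vecOf (k : Fin 4) : bell k = vecOf (pauli k) := kronecker_one_mulVec_psi _

lemma inv_sqrt_two_sq_complex : ((1 / √2 : ℝ) : ℂ) * ((1 / √2 : ℝ) : ℂ) = 1 / 2 := by
  rw [← Complex.ofReal_mul, inv_sqrt_two_sq]; norm_num

/-- Standard teleportation acts as a random Pauli rotation, with the Bell overlaps of the resource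
as probabilities. -/
lemma sesq_teleport (σ : Op) (φ : Fin 2 → ℂ) :
    sesq (teleport σ φ) φ φ = ∑ k, sesq σ (bell k) (bell k) * sesq (pauli k) φ φ ^ 2 := by
  have h2 := inv_sqrt_two_sq_complex
  simp only [teleport, bell_eq_vecOf, vecOf, sesq, dotProduct, mulVec, Matrix.sum_apply,
    Matrix.mul_apply, Matrix.of_apply, conjTranspose_apply, Fintype.sum_prod_type,
    Fin.sum_univ_two, Fin.sum_univ_four, pauli, sigmaY, cons_val_zero, cons_val_one, cons_val,
    Pi.star_apply, star_mul', Complex.star_def, Complex.conj_ofReal]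
  generalize ((1 / √2 : ℝ) : ℂ) = s at h2
  simp
  ring_nf
  simp [Complex.I_pow_four]
  ring

lemma trace_eq_sum_bell (σ : Op) : σ.trace = ∑ k, sesq σ (bell k) (bell k) := by
  have h2 := inv_sqrt_two_sq_complex
  simp only [bell_eq_vecOf, vecOf, sesq, dotProduct, mulVec, Matrix.trace, Matrix.diag,
    Fintype.sum_prod_type, Fin.sum_univ_two, Fin.sum_univ_four, pauli, sigmaY, cons_val_zero,
    cons_val_one, cons_val, Pi.star_apply, star_mul', Complex.star_def, Complex.conj_ofReal]
  generalize ((1 / √2 : ℝ) : ℂ) = s at h2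
  simp
  ring_nf
  rw [sq s, h2, Complex.I_sq]
  ring

lemma bell_zero : bell 0 = psi := by simp [bell, pauli]

lemma blochVec_one (θ ω : ℝ) : blochVec θ ω 1 =
    (Real.cos ω + Real.sin ω * Complex.I) * (Real.sin (θ / 2) : ℂ) := by
  simp [blochVec, mul_comm Complex.I, Complex.exp_mul_I]

lemma sesq_pauli_blochVec (θ ω : ℝ) (k : Fin 4) :
    sesq (pauli k) (blochVec θ ω) (blochVec θ ω) =
      ((![1, Real.sin θ * Real.cos ω, Real.sin θ * Real.sin ω, Real.cos θ] k : ℝ) : ℂ) := by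
  have h0 : blochVec θ ω 0 = (Real.cos (θ / 2) : ℂ) := rfl
  have hs : Real.sin θ = 2 * Real.sin (θ / 2) * Real.cos (θ / 2) := by
    rw [← Real.sin_two_mul]; congr 1; ring
  have hc : Real.cos θ = Real.cos (θ / 2) ^ 2 - Real.sin (θ / 2) ^ 2 := by
    rw [← Real.cos_two_mul']; congr 1; ring
  have h1 := Real.sin_sq_add_cos_sq ω
  have h2 := Real.sin_sq_add_cos_sq (θ / 2)
  rw [hs, hc]
  simp only [sesq, dotProduct, mulVec, Fin.sum_univ_two, Pi.star_apply, h0, blochVec_one]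
  generalize Real.cos (θ / 2) = c at *
  generalize Real.sin (θ / 2) = s at *
  generalize Real.cos ω = C at *
  generalize Real.sin ω = S at *
  fin_cases k
  · refine Complex.ext ?_ ?_ <;> simp [pauli]
    · linear_combination s ^ 2 * h1 + h2
    · ring
  · refine Complex.ext ?_ ?_ <;> simp [pauli] <;> ring
  · refine Complex.ext ?_ ?_ <;> simp [pauli, sigmaY] <;> ring
  · refine Complex.ext ?_ ?_ <;> simp [pauli, sq]
    · linear_combination -s ^ 2 * h1
    · ring

lemma expect_teleport_blochVec (σ : Op) (θ ω : ℝ) :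
    expect (teleport σ (blochVec θ ω)) (blochVec θ ω) =
      expect σ (bell 0) + expect σ (bell 1) * (Real.sin θ * Real.cos ω) ^ 2 +
        expect σ (bell 2) * (Real.sin θ * Real.sin ω) ^ 2 + expect σ (bell 3) * Real.cos θ ^ 2 := by
  have h : ∀ (z : ℂ) (r : ℝ), (z * (r : ℂ) ^ 2).re = z.re * r ^ 2 := fun z r => by
    rw [← Complex.ofReal_pow, Complex.re_mul_ofReal]
  change (sesq _ _ _).re = _
  rw [sesq_teleport, Complex.re_sum, Fin.sum_univ_four]
  simp only [sesq_pauli_blochVec, h]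
  simp [expect, sesq]

/-- Each squared coordinate of a uniform point of the sphere has mean 1/3. -/
lemma integral_bloch (p₀ p₁ p₂ p₃ : ℝ) :
    ∫ ω in (0 : ℝ)..(2 * Real.pi), ∫ θ in (0 : ℝ)..Real.pi,
      (p₀ + p₁ * (Real.sin θ * Real.cos ω) ^ 2 + p₂ * (Real.sin θ * Real.sin ω) ^ 2 +
        p₃ * Real.cos θ ^ 2) * Real.sin θ = 4 * Real.pi * (p₀ + (p₁ + p₂ + p₃) / 3) := by
  have h1 : ∫ θ in (0 : ℝ)..Real.pi, Real.sin θ = 2 := by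
    rw [integral_sin, Real.cos_zero, Real.cos_pi]; norm_num
  have h3 : ∫ θ in (0 : ℝ)..Real.pi, Real.sin θ ^ 3 = 4 / 3 := by
    rw [integral_sin_pow_three, Real.cos_zero, Real.cos_pi]; norm_num
  have inner : ∀ ω : ℝ, ∫ θ in (0 : ℝ)..Real.pi,
      (p₀ + p₁ * (Real.sin θ * Real.cos ω) ^ 2 + p₂ * (Real.sin θ * Real.sin ω) ^ 2 +
        p₃ * Real.cos θ ^ 2) * Real.sin θ =
      (2 * p₀ + p₃ * (2 / 3)) + (p₁ * Real.cos ω ^ 2 + p₂ * Real.sin ω ^ 2) * (4 / 3) := by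
    intro ω
    have he : ∀ θ : ℝ, (p₀ + p₁ * (Real.sin θ * Real.cos ω) ^ 2 +
        p₂ * (Real.sin θ * Real.sin ω) ^ 2 + p₃ * Real.cos θ ^ 2) * Real.sin θ =
        (p₀ + p₃) * Real.sin θ +
          (p₁ * Real.cos ω ^ 2 + p₂ * Real.sin ω ^ 2 - p₃) * Real.sin θ ^ 3 := fun θ => by
      rw [Real.cos_sq' θ]; ring
    simp_rw [he]
    rw [intervalIntegral.integral_add (Continuous.intervalIntegrable (by fun_prop) _ _)
        (Continuous.intervalIntegrable (by fun_prop) _ _),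
      intervalIntegral.integral_const_mul, intervalIntegral.integral_const_mul, h1, h3]
    ring
  simp_rw [inner]
  have hc : ∫ ω in (0 : ℝ)..(2 * Real.pi), Real.cos ω ^ 2 = Real.pi := by
    rw [integral_cos_sq]; simp
  have hs : ∫ ω in (0 : ℝ)..(2 * Real.pi), Real.sin ω ^ 2 = Real.pi := by
    rw [integral_sin_sq]; simp
  have outer : ∀ K : ℝ, ∫ ω in (0 : ℝ)..(2 * Real.pi),
      (K + (p₁ * Real.cos ω ^ 2 + p₂ * Real.sin ω ^ 2) * (4 / 3)) =
        2 * Real.pi * K + (p₁ * Real.pi + p₂ * Real.pi) * (4 / 3) := fun K => by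
    rw [intervalIntegral.integral_add (by simp)
      (Continuous.intervalIntegrable (by fun_prop) _ _), intervalIntegral.integral_mul_const,
      intervalIntegral.integral_add (Continuous.intervalIntegrable (by fun_prop) _ _)
      (Continuous.intervalIntegrable (by fun_prop) _ _), intervalIntegral.integral_const_mul,
      intervalIntegral.integral_const_mul, hc, hs, intervalIntegral.integral_const, smul_eq_mul,
      sub_zero]
  rw [outer]
  ring

/-- The teleportation fidelity of a state is `(2 f + 1) / 3`, where `f` is its overlap with the
vector `|ψ⟩`. -/
lemma teleportationFidelity_eq {σ : Op} (hσ : σ.trace = 1) :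
    teleportationFidelity σ = (2 * expect σ psi + 1) / 3 := by
  have hsum : expect σ (bell 0) + expect σ (bell 1) + expect σ (bell 2) + expect σ (bell 3) = 1 := by
    have h := congrArg Complex.re (trace_eq_sum_bell σ)
    rw [hσ, Fin.sum_univ_four] at h
    exact h.symm
  rw [teleportationFidelity]
  simp_rw [expect_teleport_blochVec]
  rw [integral_bloch, ← bell_zero]
  have := Real.pi_pos
  field_simp
  linarith

end Teleportation

/-! ### Strict gain for entangled states and the final assembly. -/

section Main

lemma nsq_mulVec_le (A : Matrix (Fin 2) (Fin 2) ℂ) (x : Fin 2 → ℂ) :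
    nsq (A *ᵥ x) ≤ (∑ i, nsq (A i)) * nsq x := by
  rw [Finset.sum_mul]
  exact Finset.sum_le_sum fun i _ => normSq_dotProduct_le (A i) x

/-- Every entangled two-qubit state has a negative partial transpose. -/
lemma exists_sesq_pt_neg {ρ : Op} (hρ : ρ.PosSemidef) (hsep : ρ ∉ sepCone) :
    ∃ A : Matrix (Fin 2) (Fin 2) ℂ, (sesq (pt ρ) (vecOf A) (vecOf A)).re < 0 := by
  by_contra! h
  refine hsep (mem_sepCone_of_pt_posSemidef hρ
    (posSemidef_of_sesq (pt_isHermitian hρ.1) fun x => ?_))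
  obtain ⟨A, rfl⟩ := exists_eq_vecOf x
  exact h A

/-- A negative direction of ρ^Γ, scaled down to a contraction, is a feasible filter with value above
1/2. The scale K + 1 exceeds the squared Frobenius norm K and is never zero. -/
lemma half_lt_objective_of_optimal {ρ X : Op} (hρ : ρ.PosSemidef) (hsep : ρ ∉ sepCone)
    (hX : IsOptimal ρ X) : 1 / 2 < objective ρ X := by
  obtain ⟨A, hA⟩ := exists_sesq_pt_neg hρ hsep
  have hK : 0 ≤ ∑ i, nsq (A i) := Finset.sum_nonneg fun i _ => nsq_nonneg _
  set K := ∑ i, nsq (A i)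
  have hs : √((K + 1)⁻¹) ^ 2 = (K + 1)⁻¹ := Real.sq_sqrt (by positivity)
  have hF : IsFeasible (rankOneOp (((√((K + 1)⁻¹) : ℝ) : ℂ) • A)) := by
    rw [isFeasible_rankOneOp_iff, one_sub_conjTranspose_mul_self_posSemidef_iff]
    intro x
    rw [smul_mulVec, nsq_smul, Complex.normSq_ofReal, ← sq, hs, inv_mul_le_iff₀ (by positivity)]
    linarith [nsq_mulVec_le A x, nsq_nonneg x]
  refine lt_of_lt_of_le ?_ (hX.2 _ hF)
  rw [rankOneOp_eq_proj, objective_proj, vecOf_smul, sesq_smul_smul_re, hs]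
  have : (K + 1)⁻¹ * (sesq (pt ρ) (vecOf A) (vecOf A)).re < 0 :=
    mul_neg_of_pos_of_neg (by positivity) hA
  linarith

/-- All optimizers for an entangled state are of the form `(A ⊗ I)|ψ⟩⟨ψ|(A† ⊗ I)`. -/
lemma exists_eq_rankOneOp_of_optimal {ρ X : Op} (hρ : ρ.PosSemidef) (hsep : ρ ∉ sepCone)
    (hX : IsOptimal ρ X) : ∃ A, X = rankOneOp A := by
  suffices h : ∃ a, X = proj a by
    obtain ⟨a, rfl⟩ := h
    obtain ⟨A, rfl⟩ := exists_eq_vecOf a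
    exact ⟨A, (rankOneOp_eq_proj A).symm⟩
  induction hr : X.rank using Nat.strong_induction_on generalizing X with
  | _ r ih =>
  by_contra! h
  obtain ⟨u, e, f, hu, h0⟩ := exists_prodVec_range hX.1.1 h
  obtain ⟨hker, t, ht, hopt, hrank⟩ := optimal_sub_proj hρ hX hu h0
  -- The reduced optimizer has rank-one form by induction, yet adding the removed product projector
  -- back stays feasible; that is the excluded situation.
  obtain ⟨a, ha⟩ := ih _ (hr ▸ hrank) hopt rfl
  obtain ⟨A, rfl⟩ := exists_eq_vecOf a
  rw [← rankOneOp_eq_proj] at ha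
  have hobj := half_lt_objective_of_optimal hρ hsep hopt
  rw [ha] at hopt hobj
  rw [rankOneOp_eq_proj, objective_proj] at hobj
  refine false_of_optimal_add_proj hρ hsep hopt (by linarith) h0 hker ht ?_
  rw [← ha, sub_add_cancel]
  exact hX.1

lemma rank_rankOneOp_of_ne_zero {A : Matrix (Fin 2) (Fin 2) ℂ} (h : rankOneOp A ≠ 0) :
    (rankOneOp A).rank = 1 := by
  refine le_antisymm ?_ (Nat.one_le_iff_ne_zero.mpr fun h0 => h ?_)
  · rw [rankOneOp_eq_proj]
    exact rank_vecMulVec_le _ _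
  · rw [Matrix.rank, Submodule.finrank_eq_zero, LinearMap.range_eq_bot] at h0
    exact Matrix.ext_of_mulVec_single fun i => by
      rw [zero_mulVec]
      exact LinearMap.congr_fun h0 _

lemma trace_filterProtocol (M : Matrix (Fin 2) (Fin 2) ℂ) (σ : Op) :
    (filterProtocol M σ).trace = σ.trace := by
  have h0 : (proj ket00).trace = 1 := by
    simp [Matrix.trace, proj_apply, ket00, Fintype.sum_prod_type]
  have h1 : (1 - Mᴴ * M) ⊗ₖ (1 : Matrix (Fin 2) (Fin 2) ℂ) =
      1 - (Mᴴ * M) ⊗ₖ (1 : Matrix (Fin 2) (Fin 2) ℂ) := by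
    rw [eq_sub_iff_add_eq, ← add_kronecker, sub_add_cancel, one_kronecker_one]
  rw [filterProtocol, trace_add, trace_smul, h0, smul_eq_mul, mul_one, h1, Matrix.sub_mul,
    Matrix.one_mul, trace_sub, trace_mul_comm, ← Matrix.mul_assoc, conjTranspose_kronecker_one,
    ← mul_kronecker_mul, Matrix.one_mul, add_sub_cancel]

end Main

end TwoQubit

end

open TwoQubit
theorem theorem2 (ρ : TwoQubit.Op) (hρ : IsState ρ) :
    ∃ F : ℝ,
      -- `F` is the maximal fidelity over all trace-preserving LOCC operations
      IsGreatest {f : ℝ | ∃ Λ : Op → Op, IsLOCC Λ ∧ f = fidelity (Λ ρ)} F ∧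
      -- and the optimal value of the semidefinite program
      IsGreatest {f : ℝ | ∃ X : Op, IsFeasible X ∧ f = objective ρ X} F ∧
      -- the program has an optimizer `X = (A ⊗ I)|ψ⟩⟨ψ|(A† ⊗ I)`
      (∃ A : Matrix (Fin 2) (Fin 2) ℂ, IsOptimal ρ (rankOneOp A)) ∧
      -- each such `A` gives a filter `σ_y A†`, whose one-way protocol attains `F`
      (∀ A : Matrix (Fin 2) (Fin 2) ℂ, IsOptimal ρ (rankOneOp A) →
        (1 - Aᴴ * A).PosSemidef ∧
        IsOneWayLOCC (filterProtocol (sigmaY * Aᴴ)) ∧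
        fidelity (filterProtocol (sigmaY * Aᴴ) ρ) = F) ∧
      -- if `ρ` is entangled, then `F > 1/2`, all optimizers have rank one and the above form,
      -- and the resulting states teleport with a fidelity above `2/3`
      (IsEntangled ρ →
        1 / 2 < F ∧
        (∀ X : Op, IsOptimal ρ X →
          X.rank = 1 ∧ ∃ A : Matrix (Fin 2) (Fin 2) ℂ, X = rankOneOp A) ∧
        (∀ A : Matrix (Fin 2) (Fin 2) ℂ, IsOptimal ρ (rankOneOp A) →
          2 / 3 < teleportationFidelity (filterProtocol (sigmaY * Aᴴ) ρ))) := by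
  obtain ⟨hpos, htr⟩ := hρ
  obtain ⟨X, hX⟩ := exists_isOptimal ρ
  obtain ⟨A₀, hA₀⟩ := exists_optimal_rankOneOp hpos hX
  have hF : ∀ Y, IsFeasible Y → objective ρ Y ≤ objective ρ X := hX.2
  have hval : ∀ Y, IsOptimal ρ Y → objective ρ Y = objective ρ X := fun Y hY =>
    le_antisymm (hF Y hY.1) (hY.2 X hX.1)
  have hprot : ∀ A : Matrix (Fin 2) (Fin 2) ℂ, IsOptimal ρ (rankOneOp A) →
      (1 - Aᴴ * A).PosSemidef ∧ IsOneWayLOCC (filterProtocol (sigmaY * Aᴴ)) ∧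
        fidelity (filterProtocol (sigmaY * Aᴴ) ρ) = objective ρ X := fun A hA => by
    have hA' := isFeasible_rankOneOp_iff.mp hA.1
    have hone : IsOneWayLOCC (filterProtocol (sigmaY * Aᴴ)) := by
      refine isOneWayLOCC_filterProtocol ?_
      rw [filter_conjTranspose_mul_self]
      exact one_sub_mul_conjTranspose_posSemidef hA'
    refine ⟨hA', hone, le_antisymm (fidelity_le_of_isLOCC htr hF hone.isLOCC) ?_⟩
    rw [← hval _ hA, ← expect_filterProtocol htr]
    exact expect_psi_le_fidelity htr hF hone.isLOCC
  refine ⟨objective ρ X, ⟨?_, ?_⟩, ⟨⟨X, hX.1, rfl⟩, ?_⟩, ⟨A₀, hA₀⟩, hprot, fun hent => ?_⟩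
  · obtain ⟨-, hone, hfid⟩ := hprot A₀ hA₀
    exact ⟨_, hone.isLOCC, hfid.symm⟩
  · rintro f ⟨Λ, hΛ, rfl⟩
    exact fidelity_le_of_isLOCC htr hF hΛ
  · rintro f ⟨Y, hY, rfl⟩
    exact hF Y hY
  · have hsep : ρ ∉ sepCone := fun h => hent (isSeparable_of_mem_sepCone h htr)
    have hhalf : ∀ Y, IsOptimal ρ Y → 1 / 2 < objective ρ Y := fun Y hY =>
      half_lt_objective_of_optimal hpos hsep hY
    refine ⟨hhalf X hX, fun Y hY => ?_, fun A hA => ?_⟩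
    · obtain ⟨A, rfl⟩ := exists_eq_rankOneOp_of_optimal hpos hsep hY
      refine ⟨rank_rankOneOp_of_ne_zero fun h0 => ?_, A, rfl⟩
      -- The zero operator has objective exactly 1/2, so it is not optimal here.
      have := hhalf _ hY
      rw [h0, objective, zero_mul, trace_zero] at this
      simp at this
    · rw [teleportationFidelity_eq ((trace_filterProtocol _ _).trans htr),
        expect_filterProtocol htr]
      have := hhalf _ hA
      linarith
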